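/- **Setting.** Let $\mathbb F$ be a field and $U,V,W$ finite-dimensional $\mathbb F$-vector spaces. A tensor $t\in U\otimes V\otimes W$ is identified, via bases, with its coefficients $(t_{ijk})$; $t_{\mathsf C}\in V\otimes W\otimes U$ and $t_{\mathsf C^2}\in W\otimes U\otimes V$ are its cyclic permutations, $t^{\otimes N}$ its $N$-th tensor power, and $e\cdot t$ the direct sum of $e$ copies of $t$. Let $\langle m,m,m\rangle=\sum_{r,s,q=1}^m x_{(r,s)}\otimes y_{(s,q)}\otimes z_{(r,q)}$. A tensor $t'$ is a degeneration of $t$, written $t'\unlhd t$, if there are matrices $\alpha,\beta,\gamma$ over $\mathbb F[\lambda]$, an integer $s\ge 0$ and a tensor $t''$ over $\mathbb F[\lambda]$ with $$\lambda^s t'+\lambda^{s+1}t''=\sum_{i,j,k}t_{ijk}\,\alpha(x_i)\otimes\beta(y_j)\otimes\gamma(z_k).$$ For $\rho\in[2,3]$ and $N\ge 1$ let $$V_{\rho,N}(t)=\max\Big\{(e\,m^\rho)^{\frac1{3N}}\ :\ (e,m)\in\mathbb N\times\mathbb N,\ e\cdot\langle m,m,m\rangle\unlhd(t\otimes t_{\mathsf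 C}\otimes t_{\mathsf C^2})^{\otimes N}\Big\},\qquad V_\rho(t)=\lim_{N\to\infty}V_{\rho,N}(t).$$ A decomposition of $t$ consists of finite sets $I,J,K\subset\mathbb Z$, direct sum decompositions $U=\bigoplus_{i\in I}U_i$, $V=\bigoplus_{j\in J}V_j$, $W=\bigoplus_{k\in K}W_k$, and tensors $t(i,j,k)\in U_i\otimes V_j\otimes W_k$ such that $t=\sum_{(i,j,k)\in I\times J\times K}t(i,j,k)$. Its support is $S=\{(i,j,k)\in I\times J\times K: t(i,j,k)\ne0\}$. The support is tight if there is $d\in\mathbb Z$ with $s_1+s_2+s_3=d$ for all $s=(s_1,s_2,s_3)\in S$. Let $\mathcal D(S)$ be the set of probability distributions on $S$. For $P\in\mathcal D(S)$ and $\ell\in\{1,2,3\}$, let $P_\ell(a)=\sum_{s\in S,\ s_\ell=a}P(s)$ be the $\ell$-th marginal; $P,Q\in\mathcal D(S)$ are compatible if $P_\ell=Q_\ell$ for $\ell=1,2,3$. Let $H(p)=-\sum_x p(x)\log p(x)$ be the entropy ($0\log0=0$), and let $$\Psi_{t,\rho}(P)=\sum_{\ell=1}^3\frac{H(P_\ell)}3+\sum_{s\in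 S}P(s)\log V_\rho(t(s)).$$ Algorithm $\mathcal A$: (1) find $\hat P\in\mathcal D(S)$ maximizing $\Psi_{t,\rho}$ over $\mathcal D(S)$; (2) find $\hat Q$ maximizing $H$ over all $Q\in\mathcal D(S)$ compatible with $\hat P$; (3) output $\Psi_{t,\rho}(\hat Q)$. **Theorem 4.2.** Let $t\in U\otimes V\otimes W$ be a nonzero tensor with a decomposition whose support $S$ is tight, and let $\rho\in[2,3]$. Then the values $V_\rho(t)$ and $V_\rho(t(s))$, $s\in S$, are well defined (the maxima and the limit in the definition exist) and positive; $\Psi_{t,\rho}$ is concave on $\mathcal D(S)$; problem (1) has a solution; for each solution $\hat P$ of (1), problem (2) has exactly one solution $\hat Q$; the output $\Psi_{t,\rho}(\hat Q)$ does not depend on which solution $\hat P$ of (1) is chosen; and $$\Psi_{t,\rho}(\hat Q)\le\log V_\rho(t).$$ -/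

import Mathlib

open Filter Topology
open scoped TensorProduct Polynomial

noncomputable section

/-! ### Tensors in coordinates -/

/-- A tensor in coordinates: the array of coefficients `t x y z`. -/
abbrev CoordTensor (F X Y Z : Type*) := X → Y → Z → F

namespace CoordTensor

variable {F : Type*} [Field F]
variable {X Y Z X' Y' Z' : Type*}

/-- The matrix multiplication tensor `⟨m, n, p⟩ = ∑ x_{(r,s)} y_{(s,t)} z_{(r,t)}`. -/
def matMul (F : Type*) [Field F] (m n p : ℕ) :
    CoordTensor F (Fin m × Fin n) (Fin n × Fin p) (Fin m × Fin p) :=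
  fun x y z => if x.1 = z.1 ∧ x.2 = y.1 ∧ y.2 = z.2 then 1 else 0

/-- The cyclic permutation `t_C` of the three factors; `cyc (cyc t)` is `t_{C²}`. -/
def cyc (t : CoordTensor F X Y Z) : CoordTensor F Y Z X :=
  fun y z x => t x y z

/-- The tensor product of two tensors. -/
def prod (t : CoordTensor F X Y Z) (t' : CoordTensor F X' Y' Z') :
    CoordTensor F (X × X') (Y × Y') (Z × Z') :=
  fun x y z => t x.1 y.1 z.1 * t' x.2 y.2 z.2

/-- The `N`-fold tensor power of a tensor. -/
def power (N : ℕ) (t : CoordTensor F X Y Z) :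
    CoordTensor F (Fin N → X) (Fin N → Y) (Fin N → Z) :=
  fun x y z => ∏ n, t (x n) (y n) (z n)

/-- The direct sum `c · t = t ⊕ ⋯ ⊕ t` of `c` copies of a tensor. -/
def copies (c : ℕ) (t : CoordTensor F X Y Z) :
    CoordTensor F (Fin c × X) (Fin c × Y) (Fin c × Z) :=
  fun x y z => if x.1 = y.1 ∧ y.1 = z.1 then t x.2 y.2 z.2 else 0

/-- `DegeneratesTo t t'`: the tensor `t'` is a degeneration of `t` (`t' ⊴ t`), that is,
`λ ^ s t' + λ ^ (s + 1) t'' = ∑ t_{xyz} α(x) ⊗ β(y) ⊗ γ(z)` for some matrices `α, β, γ` with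
entries in `F[λ]`, some `s ∈ ℕ` and some tensor `t''` over `F[λ]`. -/
def DegeneratesTo [Fintype X] [Fintype Y] [Fintype Z]
    (t : CoordTensor F X Y Z) (t' : CoordTensor F X' Y' Z') : Prop :=
  ∃ (α : Matrix X' X F[X]) (β : Matrix Y' Y F[X]) (γ : Matrix Z' Z F[X]) (s : ℕ)
    (t'' : CoordTensor F[X] X' Y' Z'),
    ∀ x' y' z',
      Polynomial.X ^ s * Polynomial.C (t' x' y' z') + Polynomial.X ^ (s + 1) * t'' x' y' z' =
        ∑ x, ∑ y, ∑ z, Polynomial.C (t x y z) * (α x' x * β y' y * γ z' z)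

variable [Fintype X] [Fintype Y] [Fintype Z]

/-- The pairs `(e, m)` such that `e · ⟨m, m, m⟩ ⊴ (t ⊗ t_C ⊗ t_{C²})^{⊗ N}`. -/
def valuePairs (N : ℕ) (t : CoordTensor F X Y Z) : Set (ℕ × ℕ) :=
  {p | DegeneratesTo (power N (prod (prod t (cyc t)) (cyc (cyc t))))
    (copies p.1 (matMul F p.2 p.2 p.2))}

/-- The numbers `(e m ^ ρ) ^ (1 / (3 N))` over all pairs in `valuePairs N t`. -/
def valueCandidates (ρ : ℝ) (N : ℕ) (t : CoordTensor F X Y Z) : Set ℝ :=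
  (fun p : ℕ × ℕ => ((p.1 : ℝ) * (p.2 : ℝ) ^ ρ) ^ (1 / (3 * (N : ℝ)))) '' valuePairs N t

/-- `V_{ρ,N}(t)`, the largest candidate. -/
def valueAt (ρ : ℝ) (N : ℕ) (t : CoordTensor F X Y Z) : ℝ :=
  sSup (valueCandidates ρ N t)

/-- The value `V_ρ(t) = lim_{N → ∞} V_{ρ,N}(t)`. -/
def value (ρ : ℝ) (t : CoordTensor F X Y Z) : ℝ :=
  limUnder atTop fun N : ℕ => valueAt ρ N t

/-- The value is meaningful: every maximum in its definition is attained, the limit exists, and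
it is positive (so that its logarithm makes sense). -/
def ValueWellDefined (ρ : ℝ) (t : CoordTensor F X Y Z) : Prop :=
  (∀ N : ℕ, 0 < N → IsGreatest (valueCandidates ρ N t) (valueAt ρ N t)) ∧
    Tendsto (fun N : ℕ => valueAt ρ N t) atTop (𝓝 (value ρ t)) ∧
    0 < value ρ t

end CoordTensor

/-! ### Tensors in `U ⊗ V ⊗ W` and their decompositions -/

section Tensors

variable {F : Type*} [Field F]
variable {U V W : Type*} [AddCommGroup U] [Module F U] [FiniteDimensional F U]
  [AddCommGroup V] [Module F V] [FiniteDimensional F V]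
  [AddCommGroup W] [Module F W] [FiniteDimensional F W]

/-- The coefficients of a tensor in `U ⊗ V ⊗ W` with respect to fixed bases of `U`, `V`, `W`. -/
def tensorCoords (t : U ⊗[F] V ⊗[F] W) :
    CoordTensor F (Fin (Module.finrank F U)) (Fin (Module.finrank F V))
      (Fin (Module.finrank F W)) :=
  fun x y z =>
    (((Module.finBasis F U).tensorProduct (Module.finBasis F V)).tensorProduct
      (Module.finBasis F W)).repr t ((x, y), z)

/-- The value `V_ρ(t)` of a tensor `t ∈ U ⊗ V ⊗ W` (it does not depend on the bases used). -/
def tensorValue (ρ : ℝ) (t : U ⊗[F] V ⊗[F] W) : ℝ :=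
  (tensorCoords t).value ρ

/-- A decomposition of a tensor `t ∈ U ⊗ V ⊗ W`: direct sum decompositions
`U = ⨁_{i ∈ I} U_i`, `V = ⨁_{j ∈ J} V_j`, `W = ⨁_{k ∈ K} W_k` indexed by finite sets of
integers, and tensors `t(i,j,k) ∈ U_i ⊗ V_j ⊗ W_k` for `(i,j,k) ∈ I × J × K` with sum `t`.
(The subspaces and tensors with indices outside `I`, `J`, `K` play no role.) -/
structure TensorDecomposition (t : U ⊗[F] V ⊗[F] W) where
  I : Finset ℤ
  J : Finset ℤ
  K : Finset ℤ
  subU : ℤ → Submodule F U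
  subV : ℤ → Submodule F V
  subW : ℤ → Submodule F W
  internalU : DirectSum.IsInternal fun i : I => subU i
  internalV : DirectSum.IsInternal fun j : J => subV j
  internalW : DirectSum.IsInternal fun k : K => subW k
  comp : (s : ℤ × ℤ × ℤ) → subU s.1 ⊗[F] subV s.2.1 ⊗[F] subW s.2.2
  sum_comp : ∑ s ∈ I ×ˢ J ×ˢ K,
    TensorProduct.map
      (TensorProduct.map (subU s.1).subtype (subV s.2.1).subtype) (subW s.2.2).subtype
      (comp s) = t

open Classical in
/-- The support: the indices in `I × J × K` whose component is nonzero. -/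
def TensorDecomposition.supp {t : U ⊗[F] V ⊗[F] W} (D : TensorDecomposition t) :
    Finset (ℤ × ℤ × ℤ) :=
  (D.I ×ˢ D.J ×ˢ D.K).filter fun s => D.comp s ≠ 0

end Tensors

/-! ### Distributions on a finite set of triples of integers -/

/-- The `ℓ`-th coordinate function `α_ℓ`. -/
def tripleCoord (l : Fin 3) (s : ℤ × ℤ × ℤ) : ℤ := ![s.1, s.2.1, s.2.2] l

/-- Tightness: the sum of the three coordinates is constant on `S`. -/
def IsTight (S : Finset (ℤ × ℤ × ℤ)) : Prop :=
  ∃ d : ℤ, ∀ s ∈ S, tripleCoord 0 s + tripleCoord 1 s + tripleCoord 2 s = d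

variable {S : Finset (ℤ × ℤ × ℤ)}

/-- The marginal function `f_ℓ(a) = ∑_{s ∈ S, s_ℓ = a} f(s)`, on `α_ℓ(S)`. -/
def marginal (f : S → ℝ) (l : Fin 3) (a : S.image (tripleCoord l)) : ℝ :=
  ∑ s ∈ Finset.univ.filter (fun s : S => tripleCoord l s = a), f s

/-- The entropy `-∑ p(x) log p(x)`, with `0 log 0 = 0`. -/
def shannonEntropy {α : Type*} [Fintype α] (p : α → ℝ) : ℝ :=
  -∑ x, p x * Real.log (p x)

/-- Two functions on `S` are compatible if their three marginals agree. -/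
def Compatible (P Q : S → ℝ) : Prop := ∀ l, marginal P l = marginal Q l

/-! ### Algorithm A -/

namespace TensorDecomposition

variable {F : Type*} [Field F]
variable {U V W : Type*} [AddCommGroup U] [Module F U] [FiniteDimensional F U]
  [AddCommGroup V] [Module F V] [FiniteDimensional F V]
  [AddCommGroup W] [Module F W] [FiniteDimensional F W]
variable {t : U ⊗[F] V ⊗[F] W}

/-- `Ψ_{t,ρ}(P) = ∑_ℓ H(P_ℓ) / 3 + ∑_{s ∈ S} P(s) log V_ρ(t(s))`. -/
def Psi (D : TensorDecomposition t) (ρ : ℝ) (P : D.supp → ℝ) : ℝ :=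
  ∑ l : Fin 3, shannonEntropy (marginal P l) / 3 +
    ∑ s : D.supp, P s * Real.log (tensorValue ρ (D.comp s))

/-- `P` is a solution of the first optimization problem: it maximizes `Ψ_{t,ρ}` over all
probability distributions on the support. -/
def IsSolution1 (D : TensorDecomposition t) (ρ : ℝ) (P : D.supp → ℝ) : Prop :=
  P ∈ stdSimplex ℝ D.supp ∧ IsMaxOn (D.Psi ρ) (stdSimplex ℝ D.supp) P

/-- `Q` is a solution of the second optimization problem: it maximizes the entropy over all
probability distributions on the support that are compatible with `P`. -/
def IsSolution2 (D : TensorDecomposition t) (P Q : D.supp → ℝ) : Prop :=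
  Q ∈ {R | R ∈ stdSimplex ℝ D.supp ∧ Compatible R P} ∧
    IsMaxOn shannonEntropy {R | R ∈ stdSimplex ℝ D.supp ∧ Compatible R P} Q

/-- `v` is a possible output of Algorithm A: `v = Ψ_{t,ρ}(Q)` for some solution `P` of the first
problem and some solution `Q` of the second problem for `P`. -/
def IsOutputA (D : TensorDecomposition t) (ρ v : ℝ) : Prop :=
  ∃ P Q : D.supp → ℝ, D.IsSolution1 ρ P ∧ D.IsSolution2 P Q ∧ v = D.Psi ρ Q

end TensorDecomposition

end

/-! The lower bound is the laser method. Approximate `Q` by the frequencies of sequences `f : Fin M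
→ S`. In the `M`-th power of `t ⊗ t_C ⊗ t_{C²}`, select triples of permutations of `f` and keep only
the variables of their blocks. Each kept block is a product of symmetrized powers of the components
`t(s)`, so it yields matrix multiplication tensors. If the chosen triples do not interact, the
result is a direct sum.

Non-interaction comes from hashing the labels affinely into `ZMod p` and keeping the triples hashed
into a set free of three-term progressions. By tightness an interaction produces a progression,
which must be constant, and triples with a collision in the same bucket are discarded
(`exists_noninteracting_subset`). Up to `exp(o(M))`, by Behrend's bound, this leaves `|permClass f|³
/ n` triples, where `n` is proportional to `|compatClass f|³` divided by the product of the three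
marginal class sizes. The largest permutation class inside `compatClass f` belongs to some
compatible `u`, so the logarithm is at least `M (3 H(f) - 3 H(u) + ∑ H(f_ℓ)) - o(M)`
(`exists_independent_triples_of_isTight`). In the limit `u` becomes compatible with `Q`, and entropy
maximality of `Q` removes the loss `3 H(Q) - 3 H(u)` (`le_log_value_of_blocks`).

The value exists because pairs `(e, m)` multiply when powers are multiplied (`mul_mem_valuePairs`),
which makes `N log V_{ρ,N}` superadditive, while flattening rank bounds it linearly
(`mul_sq_le_of_mem_valuePairs`); Fekete's lemma applies.

For the algorithm, `Ψ` is linear plus a strictly concave function of the marginals. Hence all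
solutions of the first problem are compatible and define the same second problem, where strict
concavity of entropy gives a unique solution. -/

namespace CoordTensor

/-! ### The action of matrices on tensors -/

section Contract

variable {R : Type*} [CommSemiring R]
variable {X Y Z X' Y' Z' X'' Y'' Z'' : Type*}
variable [Fintype X] [Fintype Y] [Fintype Z]

/-- The action of three matrices on a tensor. -/
def contract (α : Matrix X' X R) (β : Matrix Y' Y R) (γ : Matrix Z' Z R)
    (t : CoordTensor R X Y Z) : CoordTensor R X' Y' Z' :=
  fun x' y' z' => ∑ x, ∑ y, ∑ z, t x y z * (α x' x * β y' y * γ z' z)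

theorem contract_eq_sum_prod (α : Matrix X' X R) (β : Matrix Y' Y R) (γ : Matrix Z' Z R)
    (t : CoordTensor R X Y Z) (x' : X') (y' : Y') (z' : Z') :
    contract α β γ t x' y' z' =
      ∑ p : X × Y × Z, t p.1 p.2.1 p.2.2 * (α x' p.1 * β y' p.2.1 * γ z' p.2.2) := by
  simp [contract, Fintype.sum_prod_type]

theorem contract_contract [Fintype X'] [Fintype Y'] [Fintype Z']
    (α' : Matrix X'' X' R) (β' : Matrix Y'' Y' R) (γ' : Matrix Z'' Z' R)
    (α : Matrix X' X R) (β : Matrix Y' Y R) (γ : Matrix Z' Z R) (t : CoordTensor R X Y Z) :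
    contract α' β' γ' (contract α β γ t) = contract (α' * α) (β' * β) (γ' * γ) t := by
  funext x y z
  simp only [contract_eq_sum_prod, Finset.sum_mul]
  rw [Finset.sum_comm]
  refine Finset.sum_congr rfl fun p _ => ?_
  simp only [Matrix.mul_apply, Finset.sum_mul, Finset.mul_sum,
    ← Fintype.sum_prod_type']
  let E : X' × Y' × Z' ≃ Z' × Y' × X' :=
    { toFun := fun p => (p.2.2, p.2.1, p.1)
      invFun := fun p => (p.2.2, p.2.1, p.1) }
  apply Fintype.sum_equiv E
  intro q
  simp only [E, Equiv.coe_fn_mk]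
  ring

theorem contract_add (α : Matrix X' X R) (β : Matrix Y' Y R) (γ : Matrix Z' Z R)
    (t u : CoordTensor R X Y Z) (x' : X') (y' : Y') (z' : Z') :
    contract α β γ (fun x y z => t x y z + u x y z) x' y' z' =
      contract α β γ t x' y' z' + contract α β γ u x' y' z' := by
  simp only [contract, add_mul, Finset.sum_add_distrib]

theorem contract_smul (α : Matrix X' X R) (β : Matrix Y' Y R) (γ : Matrix Z' Z R) (r : R)
    (t : CoordTensor R X Y Z) (x' : X') (y' : Y') (z' : Z') :
    contract α β γ (fun x y z => r * t x y z) x' y' z' = r * contract α β γ t x' y' z' := by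
  simp only [contract, mul_assoc, Finset.mul_sum]

theorem contract_map {R' : Type*} [CommSemiring R'] (f : R →+* R')
    (α : Matrix X' X R) (β : Matrix Y' Y R) (γ : Matrix Z' Z R)
    (t : CoordTensor R X Y Z) (x' : X') (y' : Y') (z' : Z') :
    contract (α.map f) (β.map f) (γ.map f) (fun x y z => f (t x y z)) x' y' z' =
      f (contract α β γ t x' y' z') := by
  simp [contract]

end Contract

/-! ### Degenerations: composition, products and powers -/

section Degeneration

variable {F : Type*} [Field F]
variable {X Y Z X' Y' Z' X'' Y'' Z'' : Type*}
variable [Fintype X] [Fintype Y] [Fintype Z]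

theorem degeneratesTo_iff {t : CoordTensor F X Y Z} {t' : CoordTensor F X' Y' Z'} :
    DegeneratesTo t t' ↔
      ∃ (α : Matrix X' X F[X]) (β : Matrix Y' Y F[X]) (γ : Matrix Z' Z F[X]) (s : ℕ)
        (r : CoordTensor F[X] X' Y' Z'), ∀ x' y' z',
        contract α β γ (fun x y z => Polynomial.C (t x y z)) x' y' z' =
          Polynomial.X ^ s * (Polynomial.C (t' x' y' z') + Polynomial.X * r x' y' z') := by
  unfold DegeneratesTo contract
  simp only [pow_succ, mul_add, mul_assoc, eq_comm]

theorem DegeneratesTo.of_contract {t : CoordTensor F X Y Z} (α : Matrix X' X F)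
    (β : Matrix Y' Y F) (γ : Matrix Z' Z F) : DegeneratesTo t (contract α β γ t) := by
  rw [degeneratesTo_iff]
  refine ⟨α.map Polynomial.C, β.map Polynomial.C, γ.map Polynomial.C, 0, 0, fun x' y' z' => ?_⟩
  rw [contract_map]
  simp

theorem DegeneratesTo.pullback (t : CoordTensor F X Y Z) (f : X' → X) (g : Y' → Y) (h : Z' → Z) :
    DegeneratesTo t (fun x y z => t (f x) (g y) (h z)) := by
  classical
  have : (fun x y z => t (f x) (g y) (h z)) =
      contract (fun x' x => if f x' = x then (1 : F) else 0)
        (fun x' x => if g x' = x then (1 : F) else 0)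
        (fun x' x => if h x' = x then (1 : F) else 0) t := by
    funext x y z
    simp [contract]
  rw [this]
  exact .of_contract _ _ _

theorem DegeneratesTo.refl (t : CoordTensor F X Y Z) : DegeneratesTo t t :=
  .pullback t id id id

/-- The error of the first degeneration could mask the leading term `λ^s'` of the second.
Substituting `λ ↦ λ^(s'+1)` in the first pushes its error beyond that order. -/
theorem DegeneratesTo.trans [Fintype X'] [Fintype Y'] [Fintype Z'] {t : CoordTensor F X Y Z}
    {t' : CoordTensor F X' Y' Z'} {t'' : CoordTensor F X'' Y'' Z''}
    (h : DegeneratesTo t t') (h' : DegeneratesTo t' t'') : DegeneratesTo t t'' := by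
  rw [degeneratesTo_iff] at *
  obtain ⟨α, β, γ, s, r, h⟩ := h
  obtain ⟨α', β', γ', s', r', h'⟩ := h'
  let φ : F[X] →+* F[X] := (Polynomial.expand F (s' + 1)).toRingHom
  have hC (a : F) : φ (Polynomial.C a) = Polynomial.C a := Polynomial.expand_C _ _
  have hX : φ Polynomial.X = Polynomial.X ^ (s' + 1) := Polynomial.expand_X _
  refine ⟨α' * α.map φ, β' * β.map φ, γ' * γ.map φ, (s' + 1) * s + s',
    fun x y z => r' x y z + contract α' β' γ' (fun x y z => φ (r x y z)) x y z,
    fun x y z => ?_⟩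
  have key : contract (α.map φ) (β.map φ) (γ.map φ) (fun x y z => Polynomial.C (t x y z)) =
      fun x y z => Polynomial.X ^ ((s' + 1) * s) * (Polynomial.C (t' x y z) +
        Polynomial.X ^ (s' + 1) * φ (r x y z)) := by
    funext x y z
    have := contract_map φ α β γ (fun x y z => Polynomial.C (t x y z)) x y z
    simp only [hC] at this
    rw [this, h]
    simp only [map_mul, map_add, map_pow, hC, hX, pow_mul]
  rw [← contract_contract, key, contract_smul, contract_add, contract_smul, h']
  ring

section Prod

variable {X₂ Y₂ Z₂ X₂' Y₂' Z₂' : Type*} [Fintype X₂] [Fintype Y₂] [Fintype Z₂]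

theorem contract_prod {R : Type*} [CommSemiring R]
    (α : Matrix X' X R) (β : Matrix Y' Y R) (γ : Matrix Z' Z R) (t : CoordTensor R X Y Z)
    (α₂ : Matrix X₂' X₂ R) (β₂ : Matrix Y₂' Y₂ R) (γ₂ : Matrix Z₂' Z₂ R)
    (t₂ : CoordTensor R X₂ Y₂ Z₂) (x : X' × X₂') (y : Y' × Y₂') (z : Z' × Z₂') :
    contract (fun (x' : X' × X₂') (x : X × X₂) => α x'.1 x.1 * α₂ x'.2 x.2)
      (fun (y' : Y' × Y₂') (y : Y × Y₂) => β y'.1 y.1 * β₂ y'.2 y.2)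
      (fun (z' : Z' × Z₂') (z : Z × Z₂) => γ z'.1 z.1 * γ₂ z'.2 z.2)
      (fun x y z => t x.1 y.1 z.1 * t₂ x.2 y.2 z.2) x y z =
      contract α β γ t x.1 y.1 z.1 * contract α₂ β₂ γ₂ t₂ x.2 y.2 z.2 := by
  rw [contract_eq_sum_prod α, contract_eq_sum_prod α₂, Finset.sum_mul_sum,
    ← Fintype.sum_prod_type']
  refine (contract_eq_sum_prod _ _ _ _ _ _ _).trans ?_
  let E : (X × X₂) × (Y × Y₂) × (Z × Z₂) ≃ (X × Y × Z) × (X₂ × Y₂ × Z₂) :=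
    { toFun := fun p => ((p.1.1, p.2.1.1, p.2.2.1), (p.1.2, p.2.1.2, p.2.2.2))
      invFun := fun q => ((q.1.1, q.2.1), (q.1.2.1, q.2.2.1), (q.1.2.2, q.2.2.2)) }
  apply Fintype.sum_equiv E
  intro p
  simp only [E, Equiv.coe_fn_mk]
  ring

theorem DegeneratesTo.prod {t : CoordTensor F X Y Z} {t' : CoordTensor F X' Y' Z'}
    {t₂ : CoordTensor F X₂ Y₂ Z₂} {t₂' : CoordTensor F X₂' Y₂' Z₂'}
    (h : DegeneratesTo t t') (h₂ : DegeneratesTo t₂ t₂') :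
    DegeneratesTo (prod t t₂) (prod t' t₂') := by
  rw [degeneratesTo_iff] at *
  obtain ⟨α, β, γ, s, r, h⟩ := h
  obtain ⟨α₂, β₂, γ₂, s₂, r₂, h₂⟩ := h₂
  refine ⟨fun x' x => α x'.1 x.1 * α₂ x'.2 x.2, fun x' x => β x'.1 x.1 * β₂ x'.2 x.2,
    fun x' x => γ x'.1 x.1 * γ₂ x'.2 x.2, s + s₂,
    fun x y z => Polynomial.C (t' x.1 y.1 z.1) * r₂ x.2 y.2 z.2 +
      r x.1 y.1 z.1 * Polynomial.C (t₂' x.2 y.2 z.2) +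
      Polynomial.X * (r x.1 y.1 z.1 * r₂ x.2 y.2 z.2), fun x y z => ?_⟩
  have := contract_prod α β γ (fun x y z => Polynomial.C (t x y z)) α₂ β₂ γ₂
      (fun x y z => Polynomial.C (t₂ x y z)) x y z
  simp only [CoordTensor.prod, map_mul]
  rw [this, h, h₂]
  ring

end Prod

theorem contract_cyc {R : Type*} [CommSemiring R]
    (α : Matrix X' X R) (β : Matrix Y' Y R) (γ : Matrix Z' Z R) (t : CoordTensor R X Y Z)
    (x : X') (y : Y') (z : Z') :
    contract β γ α (fun y z x => t x y z) y z x = contract α β γ t x y z := by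
  simp only [contract]
  rw [Finset.sum_congr rfl fun y _ => Finset.sum_comm, Finset.sum_comm]
  refine Finset.sum_congr rfl fun x _ => Finset.sum_congr rfl fun y _ =>
    Finset.sum_congr rfl fun z _ => ?_
  ring

theorem DegeneratesTo.cyc {t : CoordTensor F X Y Z} {t' : CoordTensor F X' Y' Z'}
    (h : DegeneratesTo t t') : DegeneratesTo (cyc t) (cyc t') := by
  rw [degeneratesTo_iff] at *
  obtain ⟨α, β, γ, s, r, h⟩ := h
  refine ⟨β, γ, α, s, fun y z x => r x y z, fun y z x => ?_⟩
  exact (contract_cyc α β γ (fun x y z => Polynomial.C (t x y z)) x y z).trans (h x y z)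

section Pi

variable {ι : Type*} [Fintype ι]

/-- The tensor product of a finite family of tensors. -/
def pi {X Y Z : ι → Type*} (t : ∀ i, CoordTensor F (X i) (Y i) (Z i)) :
    CoordTensor F (∀ i, X i) (∀ i, Y i) (∀ i, Z i) :=
  fun x y z => ∏ i, t i (x i) (y i) (z i)

variable [DecidableEq ι] {X Y Z X' Y' Z' : ι → Type*}
variable [∀ i, Fintype (X i)] [∀ i, Fintype (Y i)] [∀ i, Fintype (Z i)]

theorem contract_pi {R : Type*} [CommSemiring R]
    (α : ∀ i, Matrix (X' i) (X i) R) (β : ∀ i, Matrix (Y' i) (Y i) R)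
    (γ : ∀ i, Matrix (Z' i) (Z i) R) (t : ∀ i, CoordTensor R (X i) (Y i) (Z i))
    (x : ∀ i, X' i) (y : ∀ i, Y' i) (z : ∀ i, Z' i) :
    contract (fun (x' : ∀ i, X' i) (x : ∀ i, X i) => ∏ i, α i (x' i) (x i))
      (fun (y' : ∀ i, Y' i) (y : ∀ i, Y i) => ∏ i, β i (y' i) (y i))
      (fun (z' : ∀ i, Z' i) (z : ∀ i, Z i) => ∏ i, γ i (z' i) (z i)) (fun x y z => ∏ i, t i (x i) (y i) (z i)) x y z =
      ∏ i, contract (α i) (β i) (γ i) (t i) (x i) (y i) (z i) := by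
  simp only [contract, Finset.prod_univ_sum, Fintype.piFinset_univ, Finset.prod_mul_distrib]

theorem DegeneratesTo.pi {t : ∀ i, CoordTensor F (X i) (Y i) (Z i)}
    {t' : ∀ i, CoordTensor F (X' i) (Y' i) (Z' i)} (h : ∀ i, DegeneratesTo (t i) (t' i)) :
    DegeneratesTo (pi t) (pi t') := by
  simp only [degeneratesTo_iff] at h
  choose α β γ s r h using h
  have hd (x : ∀ i, X' i) (y : ∀ i, Y' i) (z : ∀ i, Z' i) : ∃ q : F[X],
      ∏ i, (Polynomial.C (t' i (x i) (y i) (z i)) + Polynomial.X * r i (x i) (y i) (z i)) =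
        Polynomial.C (∏ i, t' i (x i) (y i) (z i)) + Polynomial.X * q := by
    -- All error terms are divisible by `λ`, which is checked by evaluating at `λ = 0`.
    have : Polynomial.X ∣ ∏ i, (Polynomial.C (t' i (x i) (y i) (z i)) +
        Polynomial.X * r i (x i) (y i) (z i)) - Polynomial.C (∏ i, t' i (x i) (y i) (z i)) := by
      rw [Polynomial.X_dvd_iff, Polynomial.coeff_zero_eq_eval_zero]
      simp [Polynomial.eval_prod]
    obtain ⟨q, hq⟩ := this
    exact ⟨q, by rw [← hq]; ring⟩
  choose q hq using hd
  rw [degeneratesTo_iff]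
  refine ⟨fun x' x => ∏ i, α i (x' i) (x i), fun x' x => ∏ i, β i (x' i) (x i),
    fun x' x => ∏ i, γ i (x' i) (x i), ∑ i, s i, q, fun x y z => ?_⟩
  have := contract_pi α β γ (fun i x y z => Polynomial.C (t i x y z)) x y z
  simp only [CoordTensor.pi, map_prod] at hq ⊢
  rw [this, ← hq, ← Finset.prod_pow_eq_pow_sum, ← Finset.prod_mul_distrib]
  exact Finset.prod_congr rfl fun i _ => h i _ _ _

end Pi

theorem DegeneratesTo.power {t : CoordTensor F X Y Z} {t' : CoordTensor F X' Y' Z'}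
    (h : DegeneratesTo t t') (N : ℕ) : DegeneratesTo (power N t) (power N t') :=
  DegeneratesTo.pi fun _ : Fin N => h

theorem DegeneratesTo.copies {t : CoordTensor F X Y Z} {t' : CoordTensor F X' Y' Z'}
    (h : DegeneratesTo t t') (c : ℕ) : DegeneratesTo (copies c t) (copies c t') := by
  have := (DegeneratesTo.refl
    (fun a b d : Fin c => if a = b ∧ b = d then (1 : F) else 0)).prod h
  convert this using 1 <;>
  · funext x y z
    simp [CoordTensor.copies, CoordTensor.prod]

/-! ### Combining matrix multiplication tensors -/

/-- The symmetrized tensor `t ⊗ t_C ⊗ t_{C²}`. -/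
def symm (t : CoordTensor F X Y Z) :
    CoordTensor F ((X × Y) × Z) ((Y × Z) × X) ((Z × X) × Y) :=
  prod (prod t (cyc t)) (cyc (cyc t))

theorem DegeneratesTo.symm {t : CoordTensor F X Y Z} {t' : CoordTensor F X' Y' Z'}
    (h : DegeneratesTo t t') : DegeneratesTo (symm t) (symm t') :=
  (h.prod h.cyc).prod h.cyc.cyc

theorem valuePairs_mono [Fintype X'] [Fintype Y'] [Fintype Z'] {t : CoordTensor F X Y Z}
    {t' : CoordTensor F X' Y' Z'} (h : DegeneratesTo t t') (N : ℕ) :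
    valuePairs N t' ⊆ valuePairs N t :=
  fun _ hp => (h.symm.power N).trans hp

/-- A direct sum of products of copies of matrix multiplication tensors is again, up to
reindexing, a direct sum of copies of a matrix multiplication tensor. -/
theorem degeneratesTo_copies_prod {ι : Type*} [Fintype ι] [DecidableEq ι] (c : ℕ) (e m : ι → ℕ) :
    DegeneratesTo (CoordTensor.copies c (pi fun i => CoordTensor.copies (e i)
        (matMul F (m i) (m i) (m i))))
      (CoordTensor.copies (c * ∏ i, e i) (matMul F (∏ i, m i) (∏ i, m i) (∏ i, m i))) := by
  -- Arbitrary bijections suffice, since both tensors only test equality of indices.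
  have E : Fin (c * ∏ i, e i) ≃ Fin c × ∀ i, Fin (e i) := Fintype.equivOfCardEq (by simp)
  have M : Fin (∏ i, m i) ≃ ∀ i, Fin (m i) := Fintype.equivOfCardEq (by simp)
  let f (x : Fin (c * ∏ i, e i) × (Fin (∏ i, m i) × Fin (∏ i, m i))) :
      Fin c × ∀ i, Fin (e i) × (Fin (m i) × Fin (m i)) :=
    ((E x.1).1, fun i => ((E x.1).2 i, M x.2.1 i, M x.2.2 i))
  convert DegeneratesTo.pullback _ f f f using 1
  funext x y z
  simp only [CoordTensor.copies, matMul, CoordTensor.pi, f]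
  have h1 : x.1 = y.1 ↔ (E x.1).1 = (E y.1).1 ∧ ∀ i, (E x.1).2 i = (E y.1).2 i := by
    rw [← E.apply_eq_iff_eq, Prod.ext_iff, funext_iff]
  have h2 : y.1 = z.1 ↔ (E y.1).1 = (E z.1).1 ∧ ∀ i, (E y.1).2 i = (E z.1).2 i := by
    rw [← E.apply_eq_iff_eq, Prod.ext_iff, funext_iff]
  have h3 (a b : Fin (∏ i, m i)) : a = b ↔ ∀ i, M a i = M b i := by
    rw [← M.apply_eq_iff_eq, funext_iff]
  simp only [← ite_and, Finset.prod_ite_zero, Finset.prod_const_one, h1, h2, h3, Finset.mem_univ,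
    true_imp_iff]
  refine if_congr ?_ rfl rfl
  constructor
  · rintro ⟨⟨⟨a, b⟩, c, d⟩, e, f, g⟩
    exact ⟨⟨a, c⟩, fun i => ⟨⟨b i, d i⟩, e i, f i, g i⟩⟩
  · rintro ⟨⟨a, c⟩, h⟩
    exact ⟨⟨⟨a, fun i => (h i).1.1⟩, c, fun i => (h i).1.2⟩, fun i => (h i).2.1,
      fun i => (h i).2.2.1, fun i => (h i).2.2.2⟩

/-- The common engine of superadditivity (two factors, one copy) and of the laser method (one factor
per symbol `s`, many copies). -/
theorem mem_valuePairs_of_degeneratesTo_copies {ι : Type*} [Fintype ι] {X' Y' Z' : ι → Type*}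
    [∀ i, Fintype (X' i)] [∀ i, Fintype (Y' i)] [∀ i, Fintype (Z' i)]
    {t : CoordTensor F X Y Z} {u : ∀ i, CoordTensor F (X' i) (Y' i) (Z' i)}
    {n e m : ι → ℕ} (h : ∀ i, (e i, m i) ∈ valuePairs (n i) (u i)) {N c : ℕ}
    (hc : DegeneratesTo (CoordTensor.power N (CoordTensor.symm t))
      (CoordTensor.copies c (pi fun i => CoordTensor.power (n i) (CoordTensor.symm (u i))))) :
    (c * ∏ i, e i, ∏ i, m i) ∈ valuePairs N t := by
  classical
  exact hc.trans (((DegeneratesTo.pi h).copies c).trans (degeneratesTo_copies_prod c e m))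

theorem mul_mem_valuePairs {t : CoordTensor F X Y Z} {N N' e e' m m' : ℕ}
    (h : (e, m) ∈ valuePairs N t) (h' : (e', m') ∈ valuePairs N' t) :
    (e * e', m * m') ∈ valuePairs (N + N') t := by
  have key := mem_valuePairs_of_degeneratesTo_copies (ι := Bool) (t := t) (u := fun _ => t)
    (n := fun b => cond b N N') (e := fun b => cond b e e') (m := fun b => cond b m m')
    (by rintro (_ | _) <;> assumption) (N := N + N') (c := 1) ?_
  · simpa [Fintype.prod_bool] using key
  · have E : Fin (N + N') ≃ Σ b : Bool, Fin (cond b N N') := Fintype.equivOfCardEq (by simp)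
    convert DegeneratesTo.pullback (CoordTensor.power (N + N') (CoordTensor.symm t))
      (fun x : Fin 1 × ((b : Bool) → Fin (cond b N N') → _) => fun n => x.2 (E n).1 (E n).2)
      (fun x : Fin 1 × ((b : Bool) → Fin (cond b N N') → _) => fun n => x.2 (E n).1 (E n).2)
      (fun x : Fin 1 × ((b : Bool) → Fin (cond b N N') → _) => fun n => x.2 (E n).1 (E n).2)
      using 1
    funext x y z
    simp only [CoordTensor.copies, CoordTensor.pi, CoordTensor.power]
    rw [if_pos ⟨Subsingleton.elim _ _, Subsingleton.elim _ _⟩]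
    rw [E.prod_comp fun p => CoordTensor.symm t (x.2 p.1 p.2) (y.2 p.1 p.2) (z.2 p.1 p.2),
      Fintype.prod_sigma]

end Degeneration

end CoordTensor

namespace CoordTensor

variable {F : Type*} [Field F]
variable {X Y Z : Type*} [Fintype X] [Fintype Y] [Fintype Z]

/-! ### The flattening bound -/

/-- If the slices `t' x` of a degeneration `t'` of `t` are linearly independent, then there are
at most as many of them as there are slices of `t`. -/
theorem DegeneratesTo.card_le {X' Y' Z' : Type*} [Fintype X'] {t : CoordTensor F X Y Z}
    {t' : CoordTensor F X' Y' Z'} (h : DegeneratesTo t t') (hli : LinearIndependent F t') :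
    Fintype.card X' ≤ Fintype.card X := by
  rw [degeneratesTo_iff] at h
  obtain ⟨α, β, γ, s, r, h⟩ := h
  -- Suppose the rows of `α` satisfy a relation. Contracting it and setting `λ = 0` gives a relation
  -- between the slices of `t'`, so all coefficients are divisible by `λ`. Dividing and repeating,
  -- they are divisible by every power of `λ`.
  have hα : LinearIndependent F[X] (fun x' => (α x' : X → F[X])) := by
    rw [Fintype.linearIndependent_iff]
    intro c hc
    have hdvd (k : ℕ) : ∃ d : X' → F[X], ∀ x', c x' = Polynomial.X ^ k * d x' := by
      induction k with
      | zero => exact ⟨c, fun x' => by simp⟩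
      | succ k ih =>
        obtain ⟨d, hd⟩ := ih
        have hd0 (x : X) : ∑ x', d x' * α x' x = 0 := by
          have h1 := congrFun hc x
          simp only [Finset.sum_apply, Pi.smul_apply, smul_eq_mul, hd, mul_assoc,
            ← Finset.mul_sum, Pi.zero_apply] at h1
          exact (mul_eq_zero.1 h1).resolve_left (pow_ne_zero _ Polynomial.X_ne_zero)
        have h2 (y' : Y') (z' : Z') : ∑ x', d x' * (Polynomial.C (t' x' y' z') +
            Polynomial.X * r x' y' z') = 0 := by
          have h3 : ∑ x', d x' * contract α β γ (fun x y z => Polynomial.C (t x y z)) x' y' z'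
              = 0 := by
            have h4 : ∀ x', d x' * contract α β γ (fun x y z => Polynomial.C (t x y z)) x' y' z'
                = ∑ x, (d x' * α x' x) *
                  ∑ y, ∑ z, Polynomial.C (t x y z) * (β y' y * γ z' z) := by
              intro x'
              simp only [contract, Finset.mul_sum]
              refine Finset.sum_congr rfl fun x _ => Finset.sum_congr rfl fun y _ =>
                Finset.sum_congr rfl fun z _ => ?_
              ring
            simp only [h4]
            rw [Finset.sum_comm]
            simp only [← Finset.sum_mul, hd0, zero_mul, Finset.sum_const_zero]
          simp only [h, mul_left_comm _ (Polynomial.X ^ s), ← Finset.mul_sum] at h3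
          exact (mul_eq_zero.1 h3).resolve_left (pow_ne_zero _ Polynomial.X_ne_zero)
        have h5 : ∀ x', (d x').eval 0 = 0 := by
          refine Fintype.linearIndependent_iff.1 hli (fun x' => (d x').eval 0) ?_
          funext y' z'
          have := congrArg (Polynomial.eval 0) (h2 y' z')
          simpa [Polynomial.eval_finsetSum] using this
        have h6 (x' : X') : ∃ q, d x' = Polynomial.X * q := by
          have : Polynomial.X ∣ d x' := by
            rw [Polynomial.X_dvd_iff, Polynomial.coeff_zero_eq_eval_zero, h5]
          exact this
        choose q hq using h6
        exact ⟨q, fun x' => by rw [hd, hq]; ring⟩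
    intro x'
    by_contra hne
    obtain ⟨d, hd⟩ := hdvd ((c x').natDegree + 1)
    have hd0 : d x' ≠ 0 := by
      rintro h0
      rw [hd, h0, mul_zero] at hne
      exact hne rfl
    have := congrArg Polynomial.natDegree (hd x')
    rw [Polynomial.natDegree_mul (pow_ne_zero _ Polynomial.X_ne_zero) hd0,
      Polynomial.natDegree_X_pow] at this
    omega
  simpa using hα.fintype_card_le_finrank

theorem linearIndependent_copies_matMul (e m : ℕ) :
    LinearIndependent F (copies e (matMul F m m m)) := by
  rw [Fintype.linearIndependent_iff]
  rintro c hc ⟨a, i, j⟩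
  -- This entry isolates the coefficient of `(a, i, j)`; the summation index shared by `y` and `z`
  -- is arbitrary, and `i` is at hand.
  have := congrFun (congrFun hc (a, j, i)) (a, i, i)
  simp only [Finset.sum_apply, Pi.smul_apply, smul_eq_mul, Pi.zero_apply] at this
  rw [Finset.sum_eq_single (a, i, j)] at this
  · simpa [copies, matMul] using this
  · rintro ⟨b, k, l⟩ - hne
    rw [copies]
    split_ifs with h1
    · rw [matMul, if_neg, mul_zero]
      rintro ⟨h2, h3, -⟩
      simp only at h1 h2 h3
      exact hne (by rw [h1.1, h2, h3])
    · simp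
  · simp

theorem mul_sq_le_of_mem_valuePairs {t : CoordTensor F X Y Z} {N e m : ℕ}
    (h : (e, m) ∈ valuePairs N t) :
    e * m ^ 2 ≤ (Fintype.card X * Fintype.card Y * Fintype.card Z) ^ N := by
  have := DegeneratesTo.card_le h (linearIndependent_copies_matMul _ _)
  simpa [sq] using this

/-! ### Existence and basic properties of the value -/

/-- Restrict to one nonzero coefficient and normalize it to `1`, putting the whole scalar `a⁻ᴺ` into
the first matrix. -/
theorem one_mem_valuePairs {t : CoordTensor F X Y Z} (ht : t ≠ 0) (N : ℕ) :
    (1, 1) ∈ valuePairs N t := by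
  classical
  obtain ⟨x, y, z, h⟩ : ∃ x y z, t x y z ≠ 0 := by
    by_contra! h
    exact ht (funext fun x => funext fun y => funext fun z => h x y z)
  have hs : CoordTensor.symm t ((x, y), z) ((y, z), x) ((z, x), y) ≠ 0 := by
    simp [CoordTensor.symm, prod, cyc, h]
  set a := CoordTensor.symm t ((x, y), z) ((y, z), x) ((z, x), y) with ha
  have key : copies 1 (matMul F 1 1 1) = contract
      (fun _ x' => if x' = (fun _ => ((x, y), z)) then (a⁻¹) ^ N else 0)
      (fun _ x' => if x' = (fun _ => ((y, z), x)) then 1 else 0)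
      (fun _ x' => if x' = (fun _ => ((z, x), y)) then 1 else 0)
      (power N (CoordTensor.symm t)) := by
    funext x' y' z'
    have h1 : copies 1 (matMul F 1 1 1) x' y' z' = 1 := by
      simp [copies, matMul, Subsingleton.elim x'.1 y'.1, Subsingleton.elim y'.1 z'.1,
        eq_iff_true_of_subsingleton]
    rw [h1]
    simp [contract, power, ← ha, hs]
  change DegeneratesTo _ (copies 1 (matMul F 1 1 1))
  rw [key]
  exact .of_contract _ _ _

theorem rpow_eq_zero_of_eq_zero_or {ρ : ℝ} (hρ : 2 ≤ ρ) {N e m : ℕ} (hN : 0 < N)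
    (h : e = 0 ∨ m = 0) : ((e : ℝ) * (m : ℝ) ^ ρ) ^ (1 / (3 * (N : ℝ))) = 0 := by
  have h1 : (1 / (3 * (N : ℝ))) ≠ 0 := by positivity
  have h2 : (e : ℝ) * (m : ℝ) ^ ρ = 0 := by
    rcases h with rfl | rfl
    · simp
    · simp [Real.zero_rpow (by linarith : ρ ≠ 0)]
  rw [h2, Real.zero_rpow h1]

/-- The flattening bound confines the pairs with positive entries to a box. It does not bound pairs
with a zero entry, but these only contribute the candidate `0`. -/
theorem finite_valueCandidates {ρ : ℝ} (hρ : 2 ≤ ρ) {N : ℕ} (hN : 0 < N)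
    (t : CoordTensor F X Y Z) : (valueCandidates ρ N t).Finite := by
  set B := (Fintype.card X * Fintype.card Y * Fintype.card Z) ^ N
  refine (((Set.finite_Iic (B, B)).image fun p : ℕ × ℕ =>
    ((p.1 : ℝ) * (p.2 : ℝ) ^ ρ) ^ (1 / (3 * (N : ℝ)))).insert 0).subset ?_
  rintro _ ⟨⟨e, m⟩, hp, rfl⟩
  rcases Nat.eq_zero_or_pos e with he | he
  · exact Or.inl (rpow_eq_zero_of_eq_zero_or hρ hN (Or.inl he))
  rcases Nat.eq_zero_or_pos m with hm | hm
  · exact Or.inl (rpow_eq_zero_of_eq_zero_or hρ hN (Or.inr hm))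
  refine Or.inr ⟨(e, m), ?_, rfl⟩
  have h1 : e * m ^ 2 ≤ B := mul_sq_le_of_mem_valuePairs hp
  exact ⟨(Nat.le_mul_of_pos_right e (by positivity)).trans h1,
    ((Nat.le_self_pow two_ne_zero m).trans (Nat.le_mul_of_pos_left _ he)).trans h1⟩

theorem isGreatest_valueAt {ρ : ℝ} (hρ : 2 ≤ ρ) {t : CoordTensor F X Y Z} (ht : t ≠ 0) {N : ℕ}
    (hN : 0 < N) : IsGreatest (valueCandidates ρ N t) (valueAt ρ N t) :=
  (finite_valueCandidates hρ hN t).isCompact.isGreatest_sSup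
    ⟨_, Set.mem_image_of_mem _ (one_mem_valuePairs ht N)⟩

theorem one_le_valueAt {ρ : ℝ} (hρ : 2 ≤ ρ) {t : CoordTensor F X Y Z} (ht : t ≠ 0) {N : ℕ}
    (hN : 0 < N) : 1 ≤ valueAt ρ N t := by
  refine (isGreatest_valueAt hρ ht hN).2 ⟨_, one_mem_valuePairs ht N, ?_⟩
  simp

theorem log_le_of_mem_valuePairs {ρ : ℝ} (hρ : 2 ≤ ρ) {t : CoordTensor F X Y Z} (ht : t ≠ 0)
    {N e m : ℕ} (hN : 0 < N) (he : 0 < e) (hm : 0 < m) (h : (e, m) ∈ valuePairs N t) :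
    Real.log ((e : ℝ) * (m : ℝ) ^ ρ) ≤ 3 * N * Real.log (valueAt ρ N t) := by
  have h1 : ((e : ℝ) * (m : ℝ) ^ ρ) ^ (1 / (3 * (N : ℝ))) ≤ valueAt ρ N t :=
    (isGreatest_valueAt hρ ht hN).2 ⟨_, h, rfl⟩
  have h2 := Real.log_le_log (by positivity) h1
  rw [Real.log_rpow (by positivity)] at h2
  have h3 : (0 : ℝ) < 3 * N := by positivity
  rw [one_div, inv_mul_le_iff₀ h3] at h2
  exact h2

theorem exists_mem_valuePairs {ρ : ℝ} (hρ : 2 ≤ ρ) {t : CoordTensor F X Y Z} (ht : t ≠ 0)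
    (N : ℕ) : ∃ e m : ℕ, 0 < e ∧ 0 < m ∧ (e, m) ∈ valuePairs N t ∧
      Real.log ((e : ℝ) * (m : ℝ) ^ ρ) = 3 * N * Real.log (valueAt ρ N t) := by
  rcases Nat.eq_zero_or_pos N with rfl | hN
  -- The case `N = 0` is needed later for symbols that do not occur in a sequence.
  · exact ⟨1, 1, one_pos, one_pos, one_mem_valuePairs ht 0, by simp⟩
  obtain ⟨⟨e, m⟩, h, hv⟩ := (isGreatest_valueAt hρ ht hN).1
  simp only at hv
  have h1 := one_le_valueAt hρ ht hN
  have hem : ¬ (e = 0 ∨ m = 0) := fun h0 => by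
    rw [← hv, rpow_eq_zero_of_eq_zero_or hρ hN h0] at h1
    linarith
  push Not at hem
  have he := Nat.pos_of_ne_zero hem.1
  have hm := Nat.pos_of_ne_zero hem.2
  refine ⟨e, m, he, hm, h, ?_⟩
  rw [← hv, Real.log_rpow (by positivity)]
  field_simp

theorem log_valueAt_add_le {ρ : ℝ} (hρ : 2 ≤ ρ) {t : CoordTensor F X Y Z} (ht : t ≠ 0)
    (M N : ℕ) : 3 * M * Real.log (valueAt ρ M t) + 3 * N * Real.log (valueAt ρ N t) ≤
      3 * (M + N : ℕ) * Real.log (valueAt ρ (M + N) t) := by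
  obtain ⟨e, m, he, hm, h, hl⟩ := exists_mem_valuePairs hρ ht M
  obtain ⟨e', m', he', hm', h', hl'⟩ := exists_mem_valuePairs hρ ht N
  rcases Nat.eq_zero_or_pos (M + N) with h0 | h0
  · obtain ⟨rfl, rfl⟩ : M = 0 ∧ N = 0 := by omega
    simp
  have key := log_le_of_mem_valuePairs hρ ht h0 (Nat.mul_pos he he') (Nat.mul_pos hm hm')
    (mul_mem_valuePairs h h')
  rw [← hl, ← hl', ← Real.log_mul (by positivity) (by positivity)]
  refine le_trans (le_of_eq ?_) key
  push_cast
  rw [Real.mul_rpow (by positivity) (by positivity)]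
  congr 1
  ring

theorem log_valueAt_le {ρ : ℝ} (hρ : ρ ∈ Set.Icc (2 : ℝ) 3) {t : CoordTensor F X Y Z}
    (ht : t ≠ 0) (N : ℕ) : 3 * N * Real.log (valueAt ρ N t) ≤
      N * (2 * Real.log (Fintype.card X * Fintype.card Y * Fintype.card Z : ℕ)) := by
  obtain ⟨e, m, he, hm, h, hl⟩ := exists_mem_valuePairs hρ.1 ht N
  have h1 := mul_sq_le_of_mem_valuePairs h
  have hm1 : (1 : ℝ) ≤ m := by exact_mod_cast hm
  have he1 : (1 : ℝ) ≤ e := by exact_mod_cast he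
  have h2 : (e : ℝ) * (m : ℝ) ^ ρ ≤ ((e * m ^ 2 : ℕ) : ℝ) ^ 2 := by
    -- The exponent `4` is wasteful, but it makes the square of `e m²` appear.
    have h3 : (m : ℝ) ^ ρ ≤ (m : ℝ) ^ (4 : ℕ) := by
      rw [← Real.rpow_natCast]
      exact Real.rpow_le_rpow_of_exponent_le hm1 (by push_cast; linarith [hρ.2])
    push_cast
    calc (e : ℝ) * (m : ℝ) ^ ρ ≤ e * m ^ 4 := by gcongr
      _ ≤ (e * e) * m ^ 4 := by gcongr; nlinarith
      _ = _ := by ring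
  have h4 : ((e * m ^ 2 : ℕ) : ℝ) ≤
      ((Fintype.card X * Fintype.card Y * Fintype.card Z : ℕ) : ℝ) ^ N := by exact_mod_cast h1
  rw [← hl]
  calc _ ≤ Real.log ((((Fintype.card X * Fintype.card Y * Fintype.card Z : ℕ) : ℝ) ^ N) ^ 2) := by
        apply Real.log_le_log (by positivity)
        exact h2.trans (by gcongr)
    _ = _ := by
        rw [Real.log_pow, Real.log_pow]
        push_cast
        ring

/-- Fekete's lemma for the subadditive sequence `-3 N log V_{ρ,N}`. The value is the exponential of
a real limit, hence positive. -/
theorem valueWellDefined {ρ : ℝ} (hρ : ρ ∈ Set.Icc (2 : ℝ) 3) {t : CoordTensor F X Y Z}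
    (ht : t ≠ 0) : ValueWellDefined ρ t := by
  have hsub : Subadditive fun N : ℕ => -(3 * N * Real.log (valueAt ρ N t)) := fun M N => by
    have := log_valueAt_add_le hρ.1 ht M N
    simp only
    linarith
  have hbdd : BddBelow (Set.range fun N : ℕ => -(3 * N * Real.log (valueAt ρ N t)) / N) := by
    refine ⟨-(2 * Real.log (Fintype.card X * Fintype.card Y * Fintype.card Z : ℕ)), ?_⟩
    rintro _ ⟨N, rfl⟩
    rcases Nat.eq_zero_or_pos N with rfl | hN
    · simp only [Nat.cast_zero, mul_zero, zero_mul, neg_zero, div_zero, Left.neg_nonpos_iff]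
      have := Real.log_natCast_nonneg (Fintype.card X * Fintype.card Y * Fintype.card Z)
      positivity
    · have := log_valueAt_le hρ ht N
      simp only
      rw [le_div_iff₀ (by positivity)]
      linarith
  have hlim := hsub.tendsto_lim hbdd
  have hexp : Tendsto (fun N : ℕ => valueAt ρ N t) atTop (𝓝 (Real.exp (-hsub.lim / 3))) := by
    refine ((Real.continuous_exp.tendsto _).comp (hlim.neg.div_const 3)).congr' ?_
    filter_upwards [eventually_gt_atTop 0] with N hN
    have h1 := one_le_valueAt hρ.1 ht hN
    have : -(-(3 * N * Real.log (valueAt ρ N t)) / N) / 3 = Real.log (valueAt ρ N t) := by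
      field_simp
    simp only [Function.comp, this]
    rw [Real.exp_log (by linarith)]
  have hval : value ρ t = Real.exp (-hsub.lim / 3) := hexp.limUnder_eq
  refine ⟨fun N hN => isGreatest_valueAt hρ.1 ht hN, hval ▸ hexp, ?_⟩
  rw [hval]
  positivity

theorem tendsto_log_valueAt {ρ : ℝ} (hρ : ρ ∈ Set.Icc (2 : ℝ) 3) {t : CoordTensor F X Y Z}
    (ht : t ≠ 0) :
    Tendsto (fun N : ℕ => Real.log (valueAt ρ N t)) atTop (𝓝 (Real.log (value ρ t))) :=
  (Real.continuousAt_log (valueWellDefined hρ ht).2.2.ne').tendsto.comp (valueWellDefined hρ ht).2.1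

end CoordTensor

/-! ### Hashing with sets without three-term arithmetic progressions -/

section Hashing

open Finset

variable {p : ℕ} [Fact p.Prime] {Λ : Type*} [Fintype Λ] [DecidableEq Λ]

/-- Moving the hyperplane along a coordinate where `v` does not vanish gives `p` disjoint
translates. -/
theorem card_dotProduct_eq_zero_mul_le {v : Λ → ZMod p} (hv : v ≠ 0) :
    #{w : Λ → ZMod p | w ⬝ᵥ v = 0} * p ≤ p ^ Fintype.card Λ := by
  obtain ⟨i, hi⟩ := Function.ne_iff.1 hv
  have h1 : #(({w : Λ → ZMod p | w ⬝ᵥ v = 0} : Finset _) ×ˢ (univ : Finset (ZMod p))) ≤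
      #(univ : Finset (Λ → ZMod p)) := by
    refine card_le_card_of_injOn (fun q => q.1 + Pi.single i q.2) (fun _ _ => by simp) ?_
    rintro ⟨w, a⟩ hw ⟨w', a'⟩ hw' h
    simp only [coe_product, coe_filter, mem_univ, true_and, coe_univ, Set.mem_prod,
      Set.mem_ofPred_eq, Set.mem_univ, and_true] at hw hw' h
    have h2 := congrArg (· ⬝ᵥ v) h
    simp only [add_dotProduct, hw, hw', single_dotProduct, zero_add] at h2
    have h3 : a = a' := mul_right_cancel₀ hi h2
    subst h3
    simpa using h
  simpa [ZMod.card] using h1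

/-- The event that the blocks labelled by `x` and `y` are both hashed to `b`. -/
def HashesTo (ω : (Λ → ZMod p) × ZMod p × ZMod p) (x y : Λ → ZMod p) (b : ZMod p) : Prop :=
  ω.2.1 + ω.1 ⬝ᵥ x = b ∧ ω.2.2 + ω.1 ⬝ᵥ y = b

instance (ω : (Λ → ZMod p) × ZMod p × ZMod p) (x y : Λ → ZMod p) (b : ZMod p) :
    Decidable (HashesTo ω x y b) := inferInstanceAs (Decidable (_ ∧ _))

theorem card_hashesTo (x y : Λ → ZMod p) (b : ZMod p) :
    #{ω : (Λ → ZMod p) × ZMod p × ZMod p | HashesTo ω x y b} = p ^ Fintype.card Λ := by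
  have : ({ω : (Λ → ZMod p) × ZMod p × ZMod p | HashesTo ω x y b} : Finset _) =
      (univ : Finset (Λ → ZMod p)).image fun w => (w, b - w ⬝ᵥ x, b - w ⬝ᵥ y) := by
    ext ⟨w, s, t⟩
    simp [HashesTo, eq_sub_iff_add_eq, eq_comm]
  rw [this, card_image_of_injective _ fun w w' h => (Prod.ext_iff.1 h).1]
  simp [ZMod.card]

/-- A collision forces the random vector into a hyperplane orthogonal to a difference of labels, and
the vector then determines both shifts. So a second hit costs a further factor `p`. -/
theorem card_hashesTo_and_mul_le {x y x' y' : Λ → ZMod p} (h : x ≠ x' ∨ y ≠ y') (b : ZMod p) :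
    #{ω : (Λ → ZMod p) × ZMod p × ZMod p | HashesTo ω x y b ∧ HashesTo ω x' y' b} * p ≤
      p ^ Fintype.card Λ := by
  obtain ⟨v, hv, hvh⟩ : ∃ v : Λ → ZMod p, v ≠ 0 ∧ ∀ ω : (Λ → ZMod p) × ZMod p × ZMod p,
      HashesTo ω x y b → HashesTo ω x' y' b → ω.1 ⬝ᵥ v = 0 := by
    rcases h with h | h
    · refine ⟨x - x', sub_ne_zero.2 h, fun ω h1 h2 => ?_⟩
      rw [dotProduct_sub]
      linear_combination h1.1 - h2.1
    · refine ⟨y - y', sub_ne_zero.2 h, fun ω h1 h2 => ?_⟩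
      rw [dotProduct_sub]
      linear_combination h1.2 - h2.2
  refine (Nat.mul_le_mul_right p ?_).trans (card_dotProduct_eq_zero_mul_le hv)
  refine card_le_card_of_injOn Prod.fst (fun ω hω => ?_) ?_
  · simp only [coe_filter, mem_univ, true_and, Set.mem_ofPred_eq] at hω ⊢
    exact hvh ω hω.1 hω.2
  · rintro ⟨w, s, t⟩ hω ⟨w', s', t'⟩ hω' hw
    obtain rfl : w = w' := hw
    replace hω := (mem_filter.1 hω).2
    replace hω' := (mem_filter.1 hω').2
    have h1 : s = s' := add_right_cancel (hω.1.1.trans hω'.1.1.symm)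
    have h2 : t = t' := add_right_cancel (hω.1.2.trans hω'.1.2.symm)
    rw [h1, h2]

/-- Among the triples of blocks in `Φ`, one can choose many good ones (elements of `G`) that do
not interact with one another inside `Φ`. -/
theorem exists_noninteracting_subset {α : Type*} [DecidableEq α] (L : Fin 3 → α → Λ → ZMod p)
    (d : Λ → ZMod p) {Φ G : Finset α} (hG : G ⊆ Φ) (hsum : ∀ φ ∈ Φ, L 0 φ + L 1 φ + L 2 φ = d)
    (hinj : ∀ φ ∈ Φ, ∀ φ' ∈ Φ, L 0 φ = L 0 φ' → L 1 φ = L 1 φ' → φ = φ') {D : ℕ}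
    (hD : ∀ φ ∈ G, ∀ l, #{φ' ∈ Φ | L l φ' = L l φ} ≤ D) (hp : 6 * D ≤ p)
    {B : Finset (ZMod p)} (hB : ThreeAPFree (B : Set (ZMod p))) :
    ∃ A ⊆ G, #G * #B ≤ 2 * p ^ 2 * #A ∧ ∀ a ∈ A, ∀ b ∈ A, ∀ c ∈ A, ∀ u ∈ Φ,
      L 0 u = L 0 a → L 1 u = L 1 b → L 2 u = L 2 c → a = b ∧ b = c := by
  classical
  -- The competitors of `φ`: other elements of `Φ` that share a block with it.
  let coll (φ : α) : Finset α := {φ' ∈ Φ | φ' ≠ φ ∧ ∃ l, L l φ' = L l φ}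
  have hcoll (φ : α) (hφ : φ ∈ G) : #(coll φ) ≤ 3 * D := by
    have : coll φ ⊆ univ.biUnion fun l => {φ' ∈ Φ | L l φ' = L l φ} := by
      intro φ' h
      simp only [coll, mem_filter] at h
      obtain ⟨h1, -, l, h2⟩ := h
      simp only [mem_biUnion, mem_univ, true_and, mem_filter]
      exact ⟨l, h1, h2⟩
    refine (card_le_card this).trans (card_biUnion_le.trans ?_)
    exact (sum_le_sum fun l _ => hD φ hφ l).trans (by simp)
  let hit (ω : (Λ → ZMod p) × ZMod p × ZMod p) (φ : α) (b : ZMod p) : Prop :=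
    HashesTo ω (L 0 φ) (L 1 φ) b
  let A (ω : (Λ → ZMod p) × ZMod p × ZMod p) : Finset α :=
    {φ ∈ G | ∃ b ∈ B, hit ω φ b ∧ ∀ φ' ∈ coll φ, ¬ hit ω φ' b}
  -- Each `φ` is hashed to at most one bucket, so a hit either survives or is charged to a
  -- collision.
  have hpt (ω : (Λ → ZMod p) × ZMod p × ZMod p) :
      ∑ φ ∈ G, ∑ b ∈ B, (if hit ω φ b then 1 else 0) ≤ #(A ω) +
        ∑ φ ∈ G, ∑ b ∈ B, ∑ φ' ∈ coll φ, (if hit ω φ b ∧ hit ω φ' b then 1 else 0) := by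
    rw [card_filter, ← sum_add_distrib]
    refine sum_le_sum fun φ _ => ?_
    by_cases hb : ∃ b ∈ B, hit ω φ b
    · obtain ⟨b, hbB, hb⟩ := hb
      have h1 : ∑ b ∈ B, (if hit ω φ b then 1 else 0) ≤ 1 := by
        rw [← card_filter, card_le_one]
        intro c hc c' hc'
        rw [mem_filter] at hc hc'
        exact hc.2.1.symm.trans hc'.2.1
      refine h1.trans ?_
      by_cases hc : ∃ φ' ∈ coll φ, hit ω φ' b
      · obtain ⟨φ', hφ', hh⟩ := hc
        refine le_add_left ?_
        calc 1 = (if hit ω φ b ∧ hit ω φ' b then 1 else 0) := by rw [if_pos ⟨hb, hh⟩]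
          _ ≤ ∑ φ' ∈ coll φ, (if hit ω φ b ∧ hit ω φ' b then 1 else 0) :=
            single_le_sum (f := fun φ' => if hit ω φ b ∧ hit ω φ' b then 1 else 0)
              (fun _ _ => Nat.zero_le _) hφ'
          _ ≤ _ := single_le_sum
              (f := fun b => ∑ φ' ∈ coll φ, (if hit ω φ b ∧ hit ω φ' b then 1 else 0))
              (fun _ _ => Nat.zero_le _) hbB
      · push Not at hc
        rw [if_pos ⟨b, hbB, hb, hc⟩]
        exact le_add_right le_rfl
    · push Not at hb
      rw [sum_eq_zero fun b hbB => if_neg (hb b hbB)]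
      exact Nat.zero_le _
  set P := p ^ Fintype.card Λ with hP
  have hp0 : 0 < p := (Fact.out : p.Prime).pos
  have h1 : ∑ ω, ∑ φ ∈ G, ∑ b ∈ B, (if hit ω φ b then 1 else 0) = #G * #B * P := by
    rw [sum_comm, sum_congr rfl fun φ _ => sum_comm]
    simp only [← card_filter, hit, card_hashesTo, sum_const, smul_eq_mul, mul_assoc, hP]
  have h2 : (∑ ω, ∑ φ ∈ G, ∑ b ∈ B, ∑ φ' ∈ coll φ,
      (if hit ω φ b ∧ hit ω φ' b then 1 else 0)) * p ≤ #G * #B * (3 * D) * P := by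
    have h3 : ∑ ω, ∑ φ ∈ G, ∑ b ∈ B, ∑ φ' ∈ coll φ,
        (if hit ω φ b ∧ hit ω φ' b then 1 else 0) =
        ∑ φ ∈ G, ∑ b ∈ B, ∑ φ' ∈ coll φ,
          #{ω : (Λ → ZMod p) × ZMod p × ZMod p | hit ω φ b ∧ hit ω φ' b} := by
      rw [sum_comm]
      refine sum_congr rfl fun φ _ => ?_
      rw [sum_comm]
      refine sum_congr rfl fun b _ => ?_
      rw [sum_comm]
      exact sum_congr rfl fun φ' _ => (card_filter _ _).symm
    rw [h3]
    simp only [sum_mul]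
    calc _ ≤ ∑ φ ∈ G, ∑ b ∈ B, ∑ φ' ∈ coll φ, P := by
          refine sum_le_sum fun φ hφ => sum_le_sum fun b _ => sum_le_sum fun φ' hφ' => ?_
          refine card_hashesTo_and_mul_le ?_ b
          by_contra! h
          simp only [coll, mem_filter] at hφ'
          exact hφ'.2.1 (hinj φ' hφ'.1 φ (hG hφ) h.1.symm h.2.symm)
      _ ≤ ∑ φ ∈ G, ∑ b ∈ B, 3 * D * P := by
          refine sum_le_sum fun φ hφ => sum_le_sum fun b _ => ?_
          rw [sum_const, smul_eq_mul]
          exact Nat.mul_le_mul_right _ (hcoll φ hφ)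
      _ = _ := by
          simp only [sum_const, smul_eq_mul]
          ring
  have h3 := sum_le_sum fun ω (_ : ω ∈ (univ : Finset ((Λ → ZMod p) × ZMod p × ZMod p))) => hpt ω
  rw [sum_add_distrib, h1] at h3
  -- Since `6 D ≤ p`, collisions account for at most half of the expected hits.
  have h4 : #G * #B * P ≤ 2 * ∑ ω, #(A ω) := by
    have h5 : #G * #B * P * p ≤ (∑ ω, #(A ω)) * p + #G * #B * (3 * D) * P := by
      nlinarith
    have h6 : 2 * (#G * #B * (3 * D) * P) ≤ #G * #B * P * p := by
      calc 2 * (#G * #B * (3 * D) * P) = #G * #B * P * (6 * D) := by ring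
        _ ≤ _ := Nat.mul_le_mul_left _ hp
    refine Nat.le_of_mul_le_mul_right ?_ hp0
    linarith
  obtain ⟨ω, -, hω⟩ : ∃ ω ∈ (univ : Finset ((Λ → ZMod p) × ZMod p × ZMod p)),
      #G * #B ≤ 2 * p ^ 2 * #(A ω) := by
    refine exists_le_of_sum_le univ_nonempty ?_
    rw [sum_const, ← mul_sum, smul_eq_mul, card_univ, Fintype.card_prod, Fintype.card_prod,
      Fintype.card_fun, ZMod.card, ← hP]
    calc P * (p * p) * (#G * #B) = p ^ 2 * (#G * #B * P) := by ring
      _ ≤ p ^ 2 * (2 * ∑ ω, #(A ω)) := Nat.mul_le_mul_left _ h4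
      _ = _ := by ring
  refine ⟨A ω, filter_subset _ _, hω, fun a ha b hb c hc u hu hua hub huc => ?_⟩
  simp only [A, mem_filter] at ha hb hc
  obtain ⟨haG, β₁, hβ₁, ha, ha'⟩ := ha
  obtain ⟨hbG, β₂, hβ₂, hb, hb'⟩ := hb
  obtain ⟨hcG, β₃, hβ₃, hc, hc'⟩ := hc
  have e1 : ω.2.1 + ω.1 ⬝ᵥ L 0 u = β₁ := by rw [hua]; exact ha.1
  have e2 : ω.2.2 + ω.1 ⬝ᵥ L 1 u = β₂ := by rw [hub]; exact hb.2
  -- As `u` and `c` share the third label, the constant label sum equates the sums of their first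
  -- two. Hence `β₁, β₃, β₂` is a progression in `B` and therefore constant.
  have e3 : ω.1 ⬝ᵥ L 0 u + ω.1 ⬝ᵥ L 1 u = ω.1 ⬝ᵥ L 0 c + ω.1 ⬝ᵥ L 1 c := by
    rw [← dotProduct_add, ← dotProduct_add]
    congr 1
    have := (hsum u hu).trans (hsum c (hG hcG)).symm
    rw [huc] at this
    exact add_right_cancel this
  have e4 : β₁ + β₂ = β₃ + β₃ := by
    linear_combination e3 - e1 - e2 + hc.1 + hc.2
  have e5 : β₁ = β₃ := hB hβ₁ hβ₃ hβ₂ e4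
  have e6 : β₂ = β₃ := hB hβ₂ hβ₃ hβ₁ ((add_comm _ _).trans e4)
  subst e5 e6
  -- Now `u` lies in the common bucket and shares a block with each of `a`, `b`, `c`, which survived
  -- only if they have no competitor there.
  have key (φ : α) (h : ∀ φ' ∈ coll φ, ¬ hit ω φ' β₂) (hl : ∃ l, L l u = L l φ) : u = φ := by
    by_contra hne
    exact h u (by simp only [coll, mem_filter]; exact ⟨hu, hne, hl⟩) ⟨e1, e2⟩
  exact ⟨(key a ha' ⟨0, hua⟩).symm.trans (key b hb' ⟨1, hub⟩),
    (key b hb' ⟨1, hub⟩).symm.trans (key c hc' ⟨2, huc⟩)⟩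

/-- Sums of two numbers below `n` do not wrap around modulo `q`, so integer progression-free sets
stay progression-free. -/
theorem exists_threeAPFree_zmod {n q : ℕ} (h : 2 * n ≤ q) :
    ∃ B : Finset (ZMod q), ThreeAPFree (B : Set (ZMod q)) ∧ #B = rothNumberNat n := by
  obtain ⟨s, hs, hcard, hfree⟩ := rothNumberNat_spec n
  have hlt : ∀ a ∈ s, a < n := fun a ha => mem_range.1 (hs ha)
  refine ⟨s.image Nat.cast, ?_, ?_⟩
  · rintro _ ha _ hb _ hc habc
    simp only [coe_image, Set.mem_image, mem_coe] at ha hb hc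
    obtain ⟨a, ha, rfl⟩ := ha
    obtain ⟨b, hb, rfl⟩ := hb
    obtain ⟨c, hc, rfl⟩ := hc
    have h1 := hlt a ha
    have h2 := hlt b hb
    have h3 := hlt c hc
    have h4 : a + c = b + b := by
      have : ((a + c : ℕ) : ZMod q) = ((b + b : ℕ) : ZMod q) := by push_cast; exact habc
      rw [ZMod.natCast_eq_natCast_iff] at this
      exact Nat.ModEq.eq_of_lt_of_lt this (by omega) (by omega)
    rw [hfree ha hb hc h4]
  · rw [card_image_of_injOn, hcard]
    intro a ha b hb hab
    have h1 := hlt a ha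
    have h2 := hlt b hb
    rw [ZMod.natCast_eq_natCast_iff] at hab
    exact Nat.ModEq.eq_of_lt_of_lt hab (by omega) (by omega)

end Hashing

/-! ### Permutation classes of sequences -/

section PermClass

open Finset

variable {M : ℕ} {κ : Type*} [DecidableEq κ]

/-- The sequences that arise from `f` by permuting the positions. -/
def permClass (f : Fin M → κ) : Finset (Fin M → κ) :=
  univ.image fun σ : Equiv.Perm (Fin M) => f ∘ σ

theorem mem_permClass {f g : Fin M → κ} :
    g ∈ permClass f ↔ ∃ σ : Equiv.Perm (Fin M), f ∘ σ = g := by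
  simp [permClass]

theorem self_mem_permClass (f : Fin M → κ) : f ∈ permClass f :=
  mem_permClass.2 ⟨1, rfl⟩

theorem mem_permClass_iff_card {f g : Fin M → κ} :
    g ∈ permClass f ↔ ∀ k, #{m | g m = k} = #{m | f m = k} := by
  rw [mem_permClass]
  constructor
  · rintro ⟨σ, rfl⟩ k
    refine card_bij (fun m _ => σ m) (by simp) (fun _ _ _ _ h => σ.injective h) fun m hm => ?_
    exact ⟨σ.symm m, by simpa using hm, by simp⟩
  · intro h
    have e (k : κ) : {m // g m = k} ≃ {m // f m = k} := Fintype.equivOfCardEq (by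
      rw [Fintype.card_subtype, Fintype.card_subtype, h])
    exact ⟨Equiv.ofFiberEquiv e, funext fun m => Equiv.ofFiberEquiv_map e m⟩

theorem comp_mem_permClass {f g : Fin M → κ} (h : g ∈ permClass f)
    (σ : Equiv.Perm (Fin M)) : g ∘ σ ∈ permClass f := by
  obtain ⟨τ, rfl⟩ := mem_permClass.1 h
  exact mem_permClass.2 ⟨τ * σ, rfl⟩

theorem map_mem_permClass {κ' : Type*} [DecidableEq κ'] (c : κ → κ') {f g : Fin M → κ}
    (h : g ∈ permClass f) : c ∘ g ∈ permClass (c ∘ f) := by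
  obtain ⟨τ, rfl⟩ := mem_permClass.1 h
  exact mem_permClass.2 ⟨τ, rfl⟩

/-- Orbit–stabilizer for permutations of positions; symbols of `K` that do not occur contribute `0!
= 1`. -/
theorem card_permClass_mul {K : Finset κ} (f : Fin M → κ) (hK : ∀ m, f m ∈ K) :
    #(permClass f) * ∏ k ∈ K, (#{m | f m = k}).factorial = M.factorial := by
  have h1 : #(univ : Finset (Equiv.Perm (Fin M))) =
      ∑ g ∈ permClass f, #{σ : Equiv.Perm (Fin M) | f ∘ σ = g} :=
    card_eq_sum_card_fiberwise fun σ _ => by simp [permClass]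
  have h2 : ∀ g ∈ permClass f, #{σ : Equiv.Perm (Fin M) | f ∘ σ = g} =
      #{σ : Equiv.Perm (Fin M) | f ∘ σ = f} := by
    intro g hg
    obtain ⟨τ, rfl⟩ := mem_permClass.1 hg
    refine card_bij (fun σ _ => σ * τ⁻¹) ?_ (fun _ _ _ _ h => mul_right_cancel h) ?_
    · intro σ hσ
      simp only [mem_filter, mem_univ, true_and] at hσ ⊢
      funext m
      simpa using congrFun hσ (τ⁻¹ m)
    · intro σ hσ
      simp only [mem_filter, mem_univ, true_and] at hσ
      refine ⟨σ * τ, ?_, by simp⟩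
      simp only [mem_filter, mem_univ, true_and]
      funext m
      simpa using congrFun hσ (τ m)
  have h3 : #{σ : Equiv.Perm (Fin M) | f ∘ σ = f} = ∏ k ∈ K, (#{m | f m = k}).factorial := by
    have := DomMulAct.stabilizer_card' f
    rw [Fintype.card_subtype] at this
    rw [this]
    simp only [Fintype.card_subtype]
    refine prod_subset (fun k hk => ?_) fun k _ hk => ?_
    · obtain ⟨m, -, rfl⟩ := mem_image.1 hk
      exact hK m
    · rw [filter_false_of_mem, card_empty, Nat.factorial_zero]
      rintro m - rfl
      exact hk (mem_image_of_mem _ (mem_univ _))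
  rw [sum_congr rfl h2, sum_const, smul_eq_mul, h3, card_univ, Fintype.card_perm,
    Fintype.card_fin] at h1
  exact h1.symm

variable {S : Type*} [Fintype S] {ι : Type*} [Fintype ι]

/-- The sequences with the same marginals as `f`. -/
def compatClass (c : ι → S → κ) (f : Fin M → S) : Finset (Fin M → S) :=
  {u | ∀ l, c l ∘ u ∈ permClass (c l ∘ f)}

theorem mem_compatClass {c : ι → S → κ} {f u : Fin M → S} :
    u ∈ compatClass c f ↔ ∀ l, c l ∘ u ∈ permClass (c l ∘ f) := by
  simp [compatClass]

theorem permClass_subset_compatClass [DecidableEq S] (c : ι → S → κ) (f : Fin M → S) :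
    permClass f ⊆ compatClass c f :=
  fun _ hu => mem_compatClass.2 fun l => map_mem_permClass (c l) hu

theorem comp_mem_compatClass {c : ι → S → κ} {f u : Fin M → S} (hu : u ∈ compatClass c f)
    (σ : Equiv.Perm (Fin M)) : u ∘ σ ∈ compatClass c f :=
  mem_compatClass.2 fun l => comp_mem_permClass (mem_compatClass.1 hu l) σ

/-- Permuting positions preserves the compatibility class and acts transitively on the possible
projections, so all fibres have the same size. -/
theorem card_fiber_compatClass {c : ι → S → κ} {f : Fin M → S} (l : ι)
    {g : Fin M → κ} (hg : g ∈ permClass (c l ∘ f)) :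
    #{v ∈ compatClass c f | c l ∘ v = g} = #{v ∈ compatClass c f | c l ∘ v = c l ∘ f} := by
  obtain ⟨σ, rfl⟩ := mem_permClass.1 hg
  refine card_bij (fun v _ => v ∘ σ.symm) ?_ ?_ ?_
  · intro v hv
    rw [mem_filter] at hv ⊢
    refine ⟨comp_mem_compatClass hv.1 _, ?_⟩
    rw [← Function.comp_assoc, hv.2, Function.comp_assoc, Equiv.self_comp_symm, Function.comp_id]
  · intro v _ v' _ h
    exact σ.symm.surjective.injective_comp_right h
  · intro v hv
    rw [mem_filter] at hv
    refine ⟨v ∘ σ, mem_filter.2 ⟨comp_mem_compatClass hv.1 _, ?_⟩, ?_⟩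
    · rw [← Function.comp_assoc, hv.2]
    · rw [Function.comp_assoc, Equiv.self_comp_symm, Function.comp_id]

theorem card_fiber_mul_card_permClass (c : ι → S → κ) (f : Fin M → S) (l : ι) :
    #{v ∈ compatClass c f | c l ∘ v = c l ∘ f} * #(permClass (c l ∘ f)) =
      #(compatClass c f) := by
  rw [card_eq_sum_card_fiberwise (f := fun v => c l ∘ v) (t := permClass (c l ∘ f))
    (fun v hv => mem_compatClass.1 hv l), sum_congr rfl fun g hg => card_fiber_compatClass (c := c) l hg,
    sum_const, smul_eq_mul, mul_comm]

/-! ### Many independent triples of sequences -/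

/-- In the third power of the set of sequences with prescribed marginals, cyclically arranged
as for `t ⊗ t_C ⊗ t_{C²}`, there are many triples of a given type, no two of which interact. -/
theorem exists_independent_triples [DecidableEq S] {c : Fin 3 → S → ℤ} {d : ℤ}
    (hsum : ∀ s, c 0 s + c 1 s + c 2 s = d)
    (hinj : ∀ s s', (∀ l, c l s = c l s') → s = s') :
    ∃ C : ℕ, 0 < C ∧ ∀ (M : ℕ) (f : Fin M → S), ∃ (n : ℕ) (e : ℕ) (φ : Fin e → Fin 3 → Fin M → S),
      0 < n ∧ n * ∏ l, #(permClass (c l ∘ f)) ≤ C * #(compatClass c f) ^ 3 ∧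
      #(permClass f) ^ 3 * rothNumberNat n ≤ 32 * n ^ 2 * e ∧
      (∀ a r, φ a r ∈ permClass f) ∧
      ∀ (a : Fin 3 → Fin e) (u : Fin 3 → Fin M → S),
        (∀ l r, c (l + r) ∘ u r = c (l + r) ∘ φ (a l) r) → a 0 = a 1 ∧ a 1 = a 2 := by
  -- A prime of at least this size keeps distinct labels distinct modulo `p`.
  obtain ⟨C₀, hC₀⟩ : ∃ C₀ : ℕ, ∀ l s s', |c l s - c l s'| < (C₀ : ℤ) := by
    refine ⟨(∑ q : Fin 3 × S × S, (c q.1 q.2.1 - c q.1 q.2.2).natAbs) + 1, fun l s s' => ?_⟩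
    have := single_le_sum (f := fun q : Fin 3 × S × S => (c q.1 q.2.1 - c q.1 q.2.2).natAbs)
      (fun _ _ => Nat.zero_le _) (mem_univ (l, s, s'))
    rw [Int.abs_eq_natAbs]
    exact_mod_cast Nat.lt_succ_of_le this
  refine ⟨6 + C₀, by omega, fun M f => ?_⟩
  set Dl : Fin 3 → ℕ := fun l => #{v ∈ compatClass c f | c l ∘ v = c l ∘ f} with hDl
  set D := ∏ l, Dl l with hDdef
  have hDpos : 0 < D := prod_pos fun l _ => card_pos.2 ⟨f, mem_filter.2
    ⟨permClass_subset_compatClass c f (self_mem_permClass f), rfl⟩⟩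
  set n := (6 + C₀) * D with hn
  have hn0 : 0 < n := Nat.mul_pos (by omega) hDpos
  -- Bertrand: `2 n < p ≤ 4 n`. The lower bound gives `p ≥ 6 D`, `p ≥ C₀` and room for the Roth set;
  -- the upper bound turns `2 p²` into `32 n²`.
  obtain ⟨p, hp, hnp, hpn⟩ := Nat.exists_prime_lt_and_le_two_mul (2 * n) (by omega)
  have : Fact p.Prime := ⟨hp⟩
  have hCp : C₀ ≤ p := by nlinarith
  have hcast (l : Fin 3) (s s' : S) (h : ((c l s : ℤ) : ZMod p) = ((c l s' : ℤ) : ZMod p)) :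
      c l s = c l s' := by
    rw [ZMod.intCast_eq_intCast_iff_dvd_sub] at h
    have h1 := Int.eq_zero_of_abs_lt_dvd h ((hC₀ l s' s).trans_le (by exact_mod_cast hCp))
    omega
  obtain ⟨B, hB, hBcard⟩ := exists_threeAPFree_zmod hnp.le
  -- The shift `l + r` reflects the cyclic permutation of the `r`-th factor. Every `l` thus sees all
  -- three marginals, and the same product `D` counts collisions for each `l`.
  let L (l : Fin 3) (U : Fin 3 → Fin M → S) (q : Fin 3 × Fin M) : ZMod p :=
    ((c (l + q.1) (U q.1 q.2) : ℤ) : ZMod p)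
  have hL (l : Fin 3) (U V : Fin 3 → Fin M → S) (h : L l U = L l V) (r : Fin 3) :
      c (l + r) ∘ U r = c (l + r) ∘ V r :=
    funext fun m => hcast _ _ _ (congrFun h (r, m))
  have hrot (r : Fin 3) (s : S) : c (0 + r) s + c (1 + r) s + c (2 + r) s = d := by
    rw [← hsum s]
    have h1 (r : Fin 3) : ∑ l, c (l + r) s = ∑ l, c l s :=
      Equiv.sum_comp (Equiv.addRight r) fun l => c l s
    simpa [Fin.sum_univ_three] using h1 r
  obtain ⟨A, hAG, hAcard, hA⟩ := exists_noninteracting_subset L (fun _ => (d : ZMod p))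
    (Φ := Fintype.piFinset fun _ => compatClass c f) (G := Fintype.piFinset fun _ => permClass f)
    (Fintype.piFinset_subset _ _ fun _ => permClass_subset_compatClass c f)
    (fun U _ => by
      funext q
      simp only [L, Pi.add_apply]
      exact_mod_cast congrArg (Int.cast : ℤ → ZMod p) (hrot q.1 (U q.1 q.2)))
    (fun U _ V _ h0 h1 => by
      funext r m
      have e0 := congrFun (hL 0 U V h0 r) m
      have e1 := congrFun (hL 1 U V h1 r) m
      simp only [Function.comp] at e0 e1
      have e2 : c (2 + r) (U r m) = c (2 + r) (V r m) := by
        linarith [hrot r (U r m), hrot r (V r m)]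
      refine hinj _ _ fun l => ?_
      obtain ⟨l, rfl⟩ : ∃ l', l = l' + r := ⟨l - r, by simp⟩
      fin_cases l
      exacts [e0, e1, e2])
    (D := D)
    (fun U hU l => by
      rw [Fintype.mem_piFinset] at hU
      have h1 : ({V ∈ Fintype.piFinset fun _ => compatClass c f | L l V = L l U} : Finset _) ⊆
          Fintype.piFinset fun r => {v ∈ compatClass c f | c (l + r) ∘ v = c (l + r) ∘ U r} := by
        intro V hV
        rw [mem_filter, Fintype.mem_piFinset] at hV
        rw [Fintype.mem_piFinset]
        exact fun r => mem_filter.2 ⟨hV.1 r, hL l V U hV.2 r⟩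
      refine (card_le_card h1).trans (le_of_eq ?_)
      rw [Fintype.card_piFinset, hDdef, ← Equiv.prod_comp (Equiv.addLeft l) Dl]
      exact prod_congr rfl fun r _ =>
        card_fiber_compatClass (c := c) (l + r) (map_mem_permClass _ (hU r)))
    (by nlinarith) hB
  refine ⟨n, #A, fun a => A.equivFin.symm a, hn0, ?_, ?_, ?_, ?_⟩
  · have : D * ∏ l, #(permClass (c l ∘ f)) = #(compatClass c f) ^ 3 := by
      rw [hDdef, ← prod_mul_distrib, prod_congr rfl fun l _ => card_fiber_mul_card_permClass c f l]
      simp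
    rw [hn, mul_assoc, this]
  · rw [Fintype.card_piFinset_const, hBcard] at hAcard
    calc _ ≤ 2 * p ^ 2 * #A := hAcard
      _ ≤ 2 * (2 * (2 * n)) ^ 2 * #A := by gcongr
      _ = _ := by ring
  · exact fun a r => Fintype.mem_piFinset.1 (hAG (A.equivFin.symm a).2) r
  · intro a u hu
    have hLu (l : Fin 3) : L l u = L l (A.equivFin.symm (a l)) := by
      funext q
      simp only [L]
      exact congrArg (Int.cast : ℤ → ZMod p) (congrFun (hu l q.1) q.2)
    -- All projections of `u` come from chosen triples, so its marginals are automatically right.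
    have huΦ : u ∈ Fintype.piFinset fun _ : Fin 3 => compatClass c f := by
      rw [Fintype.mem_piFinset]
      intro r
      rw [mem_compatClass]
      intro l
      obtain ⟨l, rfl⟩ : ∃ l', l = l' + r := ⟨l - r, by simp⟩
      rw [hu l r]
      exact map_mem_permClass _ (Fintype.mem_piFinset.1 (hAG (A.equivFin.symm (a l)).2) r)
    have := hA _ (A.equivFin.symm (a 0)).2 _ (A.equivFin.symm (a 1)).2 _
      (A.equivFin.symm (a 2)).2 u huΦ (hLu 0) (hLu 1) (hLu 2)
    exact ⟨A.equivFin.symm.injective (Subtype.ext this.1),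
      A.equivFin.symm.injective (Subtype.ext this.2)⟩

end PermClass

/-! ### From independent triples to direct sums -/

namespace CoordTensor

open Finset in
/-- If a tensor `T` has blocks `t s` with support labelled by `c`, then noninteracting triples of
sequences of the type of `f` yield a direct sum of products of the blocks. -/
theorem mem_valuePairs_of_blocks {F : Type*} [Field F] {S : Type*} [Fintype S] [DecidableEq S]
    {X Y Z : Type*} [Fintype X] [Fintype Y] [Fintype Z] {XS YS ZS : S → Type*}
    [∀ s, Fintype (XS s)] [∀ s, Fintype (YS s)] [∀ s, Fintype (ZS s)]
    {T : CoordTensor F X Y Z} {t : ∀ s, CoordTensor F (XS s) (YS s) (ZS s)}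
    {fX : ∀ s, XS s → X} {fY : ∀ s, YS s → Y} {fZ : ∀ s, ZS s → Z} {c : Fin 3 → S → ℤ}
    (hblock : ∀ s x y z, T (fX s x) (fY s y) (fZ s z) = t s x y z)
    (hsupp : ∀ s s' s'' x y z, T (fX s x) (fY s' y) (fZ s'' z) ≠ 0 →
      ∃ u, c 0 u = c 0 s ∧ c 1 u = c 1 s' ∧ c 2 u = c 2 s'')
    {M e : ℕ} {f : Fin M → S} {φ : Fin e → Fin 3 → Fin M → S}
    (hφ : ∀ a r, φ a r ∈ permClass f)
    (hind : ∀ (a : Fin 3 → Fin e) (u : Fin 3 → Fin M → S),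
      (∀ l r, c (l + r) ∘ u r = c (l + r) ∘ φ (a l) r) → a 0 = a 1 ∧ a 1 = a 2)
    {es ms : S → ℕ} (hs : ∀ s, (es s, ms s) ∈ valuePairs #{m | f m = s} (t s)) :
    (e * ∏ s, es s, ∏ s, ms s) ∈ valuePairs M T := by
  refine mem_valuePairs_of_degeneratesTo_copies hs ?_
  -- Sort the positions by the symbol of `φ a r`; being a permutation of `f`, it has the same
  -- counts.
  have hE (a : Fin e) (r : Fin 3) : ∃ E : Fin M ≃ Σ s, Fin #{m | f m = s},
      ∀ m, (E m).1 = φ a r m :=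
    ⟨(Equiv.sigmaFiberEquiv (φ a r)).symm.trans (Equiv.sigmaCongrRight fun s =>
      Fintype.equivFinOfCardEq (by
        rw [Fintype.card_subtype, mem_permClass_iff_card.1 (hφ a r)])), fun m => rfl⟩
  choose E hE using hE
  convert DegeneratesTo.pullback (power M (CoordTensor.symm T))
    (fun (x : Fin e × ∀ s, Fin #{m | f m = s} → (XS s × YS s) × ZS s) m =>
      ((fX _ (x.2 (E x.1 0 m).1 (E x.1 0 m).2).1.1, fY _ (x.2 (E x.1 1 m).1 (E x.1 1 m).2).1.2),
        fZ _ (x.2 (E x.1 2 m).1 (E x.1 2 m).2).2))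
    (fun (y : Fin e × ∀ s, Fin #{m | f m = s} → (YS s × ZS s) × XS s) m =>
      ((fY _ (y.2 (E y.1 0 m).1 (E y.1 0 m).2).1.1, fZ _ (y.2 (E y.1 1 m).1 (E y.1 1 m).2).1.2),
        fX _ (y.2 (E y.1 2 m).1 (E y.1 2 m).2).2))
    (fun (z : Fin e × ∀ s, Fin #{m | f m = s} → (ZS s × XS s) × YS s) m =>
      ((fZ _ (z.2 (E z.1 0 m).1 (E z.1 0 m).2).1.1, fX _ (z.2 (E z.1 1 m).1 (E z.1 1 m).2).1.2),
        fY _ (z.2 (E z.1 2 m).1 (E z.1 2 m).2).2)) using 1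
  funext ⟨a, x⟩ ⟨b, y⟩ ⟨d, z⟩
  simp only [copies, pi, power, CoordTensor.symm, prod, cyc]
  split_ifs with h
  · obtain ⟨rfl, rfl⟩ := h
    simp only [hblock, prod_mul_distrib]
    rw [Equiv.prod_comp (E a 0) fun p => t p.1 (x p.1 p.2).1.1 (y p.1 p.2).1.1 (z p.1 p.2).1.1,
      Equiv.prod_comp (E a 1) fun p => t p.1 (z p.1 p.2).1.2 (x p.1 p.2).1.2 (y p.1 p.2).1.2,
      Equiv.prod_comp (E a 2) fun p => t p.1 (y p.1 p.2).2 (z p.1 p.2).2 (x p.1 p.2).2]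
    simp only [Fintype.prod_sigma]
  -- A nonzero coefficient would give, position by position, support symbols whose labels mix the
  -- triples `a`, `b`, `d`; independence then forces `a = b = d`.
  · symm
    by_contra hne
    rw [← ne_eq, prod_ne_zero_iff] at hne
    have h0 := fun m => hsupp _ _ _ _ _ _
      (left_ne_zero_of_mul (left_ne_zero_of_mul (hne m (mem_univ m))))
    have h1 := fun m => hsupp _ _ _ _ _ _
      (right_ne_zero_of_mul (left_ne_zero_of_mul (hne m (mem_univ m))))
    have h2 := fun m => hsupp _ _ _ _ _ _ (right_ne_zero_of_mul (hne m (mem_univ m)))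
    simp only [hE] at h0 h1 h2
    choose u0 hu0 using h0
    choose u1 hu1 using h1
    choose u2 hu2 using h2
    refine h (hind ![a, b, d] ![u0, u1, u2] fun l r => funext fun m => ?_)
    fin_cases l <;> fin_cases r
    · exact (hu0 m).1
    · exact (hu1 m).2.1
    · exact (hu2 m).2.2
    · exact (hu0 m).2.1
    · exact (hu1 m).2.2
    · exact (hu2 m).1
    · exact (hu0 m).2.2
    · exact (hu1 m).1
    · exact (hu2 m).2.1

end CoordTensor

/-! ### Entropy estimates for permutation classes -/

section Entropy

open Finset

theorem log_factorial_bounds (n : ℕ) :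
    n * Real.log n - n ≤ Real.log n.factorial ∧
      Real.log n.factorial ≤ n * Real.log n - n + (1 + Real.log (n + 1)) := by
  rcases Nat.eq_zero_or_pos n with rfl | hn
  · simp
  have hn1 : (1 : ℝ) ≤ n := by exact_mod_cast hn
  have hlog : 0 ≤ Real.log n := Real.log_nonneg hn1
  constructor
  · have := Stirling.le_log_factorial_stirling hn.ne'
    have h2 : 0 ≤ Real.log (2 * Real.pi) := Real.log_nonneg (by linarith [Real.pi_gt_three])
    linarith
  · have h1 := Stirling.log_stirlingSeq_formula n
    obtain ⟨k, rfl⟩ : ∃ k, n = k + 1 := ⟨n - 1, by omega⟩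
    have h2 : Real.log (Stirling.stirlingSeq (k + 1)) ≤ Real.log (Stirling.stirlingSeq 1) :=
      Stirling.log_stirlingSeq'_antitone (Nat.zero_le k)
    have h3 : Real.log (Stirling.stirlingSeq 1) = 1 - Real.log 2 / 2 := by
      rw [Stirling.stirlingSeq_one, Real.log_div (by positivity) (by positivity), Real.log_exp,
        Real.log_sqrt (by norm_num)]
    rw [Real.log_mul (by norm_num) (by positivity), Real.log_div (by positivity) (by positivity),
      Real.log_exp] at h1
    have h4 : Real.log ((k + 1 : ℕ) : ℝ) ≤ Real.log (((k + 1 : ℕ) : ℝ) + 1) :=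
      Real.log_le_log (by positivity) (by linarith)
    linarith

variable {M : ℕ}

/-- The relative frequencies in a finite sequence. -/
noncomputable def freq {κ : Type*} [DecidableEq κ] (f : Fin M → κ) (k : κ) : ℝ :=
  (#{m | f m = k} : ℝ) / M

theorem freq_eq_of_mem_permClass {κ : Type*} [DecidableEq κ] {f g : Fin M → κ}
    (h : g ∈ permClass f) : freq g = freq f :=
  funext fun k => by rw [freq, freq, mem_permClass_iff_card.1 h]

/-- Stirling applied to the multinomial coefficient; the linear terms cancel because the counts sum
to `M`. -/
theorem abs_log_card_permClass_sub_le {κ : Type*} [DecidableEq κ] {K : Finset κ} (hM : 0 < M)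
    (f : Fin M → κ) (hK : ∀ m, f m ∈ K) :
    |Real.log #(permClass f) - M * ∑ k ∈ K, Real.negMulLog (freq f k)| ≤
      (#K + 1) * (1 + Real.log (M + 1)) := by
  set n : κ → ℕ := fun k => #{m | f m = k} with hn
  have hsum : ∑ k ∈ K, n k = M := by
    have := card_eq_sum_card_fiberwise (s := (univ : Finset (Fin M))) (f := f) (t := K)
      fun m _ => hK m
    simpa using this.symm
  have hle (k : κ) : n k ≤ M := (card_le_univ _).trans (by simp)
  have hcard : Real.log #(permClass f) + ∑ k ∈ K, Real.log (n k).factorial =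
      Real.log M.factorial := by
    rw [← card_permClass_mul f hK, Nat.cast_mul, Nat.cast_prod, Real.log_mul, Real.log_prod]
    · exact fun k _ => by positivity
    · exact_mod_cast (card_pos.2 ⟨f, self_mem_permClass f⟩).ne'
    · exact prod_ne_zero_iff.2 fun k _ => by positivity
  have hM' : (M : ℝ) ≠ 0 := by positivity
  have hent : M * ∑ k ∈ K, Real.negMulLog (freq f k) =
      M * Real.log M - ∑ k ∈ K, n k * Real.log (n k) := by
    have h1 (k : κ) : M * Real.negMulLog (freq f k) =
        n k * Real.log M - n k * Real.log (n k) := by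
      rcases Nat.eq_zero_or_pos (n k) with h0 | h0
      · have h2 : freq f k = 0 := by
          have : #{m | f m = k} = 0 := h0
          simp [freq, this]
        simp [h0, h2]
      · have h2 : freq f k = n k / M := rfl
        have h3 : (n k : ℝ) ≠ 0 := by positivity
        rw [h2, Real.negMulLog, Real.log_div h3 hM']
        field_simp
        ring
    rw [mul_sum, sum_congr rfl fun k _ => h1 k, sum_sub_distrib, ← sum_mul, ← Nat.cast_sum, hsum]
  have hlogM : 0 ≤ Real.log ((M : ℝ) + 1) := Real.log_nonneg (by linarith [M.cast_nonneg (α := ℝ)])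
  have hlow : ∑ k ∈ K, n k * Real.log (n k) - M ≤ ∑ k ∈ K, Real.log (n k).factorial := by
    have := sum_le_sum fun k (_ : k ∈ K) => (log_factorial_bounds (n k)).1
    rw [sum_sub_distrib, ← Nat.cast_sum, hsum] at this
    exact this
  have hup : ∑ k ∈ K, Real.log (n k).factorial ≤
      ∑ k ∈ K, n k * Real.log (n k) - M + #K * (1 + Real.log (M + 1)) := by
    have h1 : ∀ k ∈ K, Real.log (n k).factorial ≤
        n k * Real.log (n k) - n k + (1 + Real.log (M + 1)) := fun k _ => by
      have h2 : Real.log ((n k : ℝ) + 1) ≤ Real.log (M + 1) :=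
        Real.log_le_log (by positivity) (by gcongr; exact hle k)
      linarith [(log_factorial_bounds (n k)).2]
    have := sum_le_sum h1
    rw [sum_add_distrib, sum_sub_distrib, ← Nat.cast_sum, hsum, sum_const, nsmul_eq_mul] at this
    exact this
  have hMf := log_factorial_bounds M
  have hK0 : 0 ≤ (#K : ℝ) * (1 + Real.log (M + 1)) := by positivity
  rw [hent, abs_le]
  constructor <;> linarith [hMf.1, hMf.2]

theorem shannonEntropy_eq_sum_negMulLog {α : Type*} [Fintype α] (p : α → ℝ) :
    shannonEntropy p = ∑ x, Real.negMulLog (p x) := by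
  simp [shannonEntropy, Real.negMulLog]

theorem continuous_shannonEntropy {α : Type*} [Fintype α] :
    Continuous (shannonEntropy : (α → ℝ) → ℝ) := by
  simp only [funext shannonEntropy_eq_sum_negMulLog]
  fun_prop

variable {S : Finset (ℤ × ℤ × ℤ)}

theorem continuous_marginal (l : Fin 3) : Continuous fun P : S → ℝ => marginal P l := by
  unfold marginal
  fun_prop

/-- The coordinate functions on `S`. -/
def coordOn (S : Finset (ℤ × ℤ × ℤ)) (l : Fin 3) (s : S) : ℤ := tripleCoord l s

theorem freq_mem_stdSimplex (hM : 0 < M) (f : Fin M → S) : freq f ∈ stdSimplex ℝ S := by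
  refine ⟨fun s => by unfold freq; positivity, ?_⟩
  have := card_eq_sum_card_fiberwise (s := (univ : Finset (Fin M))) (f := f) (t := univ)
    fun m _ => by simp
  simp only [freq, ← sum_div, ← Nat.cast_sum]
  rw [← this, card_univ, Fintype.card_fin, div_self (by positivity)]

theorem marginal_freq (f : Fin M → S) (l : Fin 3) (a : S.image (tripleCoord l)) :
    marginal (freq f) l a = freq (coordOn S l ∘ f) a := by
  simp only [marginal, freq, ← sum_div, ← Nat.cast_sum]
  congr 2
  rw [card_eq_sum_card_fiberwise (f := f) (t := univ.filter fun s : S => tripleCoord l s = a)]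
  · refine sum_congr rfl fun s hs => ?_
    congr 1
    ext m
    constructor
    · intro h
      have h1 : f m = s := (mem_filter.1 h).2
      refine mem_filter.2 ⟨mem_filter.2 ⟨mem_univ _, ?_⟩, h1⟩
      rw [Function.comp_apply, h1]
      exact (mem_filter.1 hs).2
    · exact fun h => mem_filter.2 ⟨mem_univ _, (mem_filter.1 h).2⟩
  · exact fun m hm => mem_filter.2 ⟨mem_univ _, (mem_filter.1 hm).2⟩

theorem compatible_of_mem_compatClass {f u : Fin M → S} (h : u ∈ compatClass (coordOn S) f) :
    Compatible (freq u) (freq f) := fun l => funext fun a => by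
  rw [marginal_freq, marginal_freq, freq_eq_of_mem_permClass (mem_compatClass.1 h l)]

theorem abs_log_card_permClass_sub_entropy_le (hM : 0 < M) (f : Fin M → S) :
    |Real.log #(permClass f) - M * shannonEntropy (freq f)| ≤
      (#S + 1) * (1 + Real.log (M + 1)) := by
  have := abs_log_card_permClass_sub_le hM f (K := univ) fun m => mem_univ _
  rw [shannonEntropy_eq_sum_negMulLog]
  simpa using this

theorem abs_log_card_permClass_coord_sub_entropy_le (hM : 0 < M) (f : Fin M → S) (l : Fin 3) :
    |Real.log #(permClass (coordOn S l ∘ f)) - M * shannonEntropy (marginal (freq f) l)| ≤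
      (#S + 1) * (1 + Real.log (M + 1)) := by
  have := abs_log_card_permClass_sub_le hM (coordOn S l ∘ f) (K := S.image (tripleCoord l))
    fun m => mem_image_of_mem _ (f m).2
  have h1 : (#(S.image (tripleCoord l)) : ℝ) ≤ #S := by exact_mod_cast card_image_le
  have hlogM : 0 ≤ Real.log ((M : ℝ) + 1) := Real.log_nonneg (by linarith [M.cast_nonneg (α := ℝ)])
  rw [shannonEntropy_eq_sum_negMulLog]
  simp only [marginal_freq]
  rw [sum_coe_sort (S.image (tripleCoord l)) fun a => Real.negMulLog (freq (coordOn S l ∘ f) a)]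
  exact this.trans (by gcongr)

/-- Method of types: a permutation class is determined by its counts, of which there are at most `(M
+ 1)^|S|`, so the largest class has nearly full size. -/
theorem exists_card_compatClass_le {S : Type*} [Fintype S] [DecidableEq S] {ι κ : Type*}
    [Fintype ι] [DecidableEq κ] (c : ι → S → κ) (f : Fin M → S) :
    ∃ u ∈ compatClass c f, #(compatClass c f) ≤ #(permClass u) * (M + 1) ^ Fintype.card S := by
  obtain ⟨u, hu, hmax⟩ := exists_max_image (compatClass c f) (fun u => #(permClass u))
    ⟨f, permClass_subset_compatClass c f (self_mem_permClass f)⟩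
  refine ⟨u, hu, ?_⟩
  let F (v : Fin M → S) (s : S) : Fin (M + 1) :=
    ⟨#{m | v m = s}, Nat.lt_succ_of_le ((card_le_univ _).trans (by simp))⟩
  refine (card_le_mul_card_image (f := F) _ #(permClass u) ?_).trans
    (Nat.mul_le_mul_left _ ((card_le_univ _).trans (by simp)))
  intro a ha
  obtain ⟨v, hv, rfl⟩ := mem_image.1 ha
  refine (card_le_card fun w hw => ?_).trans (hmax v hv)
  rw [mem_permClass_iff_card]
  intro s
  exact congrArg Fin.val (congrFun (mem_filter.1 hw).2 s)

theorem tendsto_log_add_one_div : Tendsto (fun M : ℕ => Real.log (M + 1) / M) atTop (𝓝 0) := by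
  have h1 : Tendsto (fun M : ℕ => Real.log (M + 1 : ℝ) / (M + 1 : ℝ)) atTop (𝓝 0) := by
    have := Real.isLittleO_log_id_atTop.tendsto_div_nhds_zero
    exact this.comp (tendsto_atTop_add_const_right _ 1 tendsto_natCast_atTop_atTop)
  have h2 : Tendsto (fun M : ℕ => ((M : ℝ) + 1) / M) atTop (𝓝 1) := by
    have := tendsto_natCast_div_add_atTop (1 : ℝ)
    simpa using this.inv₀ one_ne_zero
  have h3 := h1.mul h2
  rw [zero_mul] at h3
  refine h3.congr fun M => ?_
  have : (M : ℝ) + 1 ≠ 0 := by positivity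
  field_simp

theorem tendsto_sqrt_div (a b : ℝ) :
    Tendsto (fun M : ℕ => √(a + b * M) / M) atTop (𝓝 0) := by
  have h1 : Tendsto (fun M : ℕ => √((a / M + b) * (1 / M))) atTop (𝓝 0) := by
    have h2 : Tendsto (fun M : ℕ => (a / M + b) * (1 / (M : ℝ))) atTop (𝓝 ((0 + b) * 0)) :=
      ((tendsto_const_div_atTop_nhds_zero_nat a).add_const b).mul
        (tendsto_const_div_atTop_nhds_zero_nat 1)
    rw [mul_zero] at h2
    have h3 := (Real.continuous_sqrt.tendsto 0).comp h2
    rwa [Real.sqrt_zero] at h3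
  refine h1.congr' ?_
  filter_upwards [eventually_gt_atTop 0] with M hM
  have : (M : ℝ) ≠ 0 := by positivity
  rw [show (a / M + b) * (1 / (M : ℝ)) = (a + b * M) / (M : ℝ) ^ 2 by field_simp,
    Real.sqrt_div' _ (by positivity), Real.sqrt_sq (by positivity)]

theorem exists_independent_triples_of_isTight (hS : IsTight S) :
    ∃ err : ℕ → ℝ, Tendsto (fun M => err M / M) atTop (𝓝 0) ∧
      ∀ (M : ℕ) (f : Fin M → S), 0 < M →
        ∃ (e : ℕ) (φ : Fin e → Fin 3 → Fin M → S) (u : Fin M → S),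
          0 < e ∧ Compatible (freq u) (freq f) ∧
          M * (3 * shannonEntropy (freq f) - 3 * shannonEntropy (freq u) +
            ∑ l, shannonEntropy (marginal (freq f) l)) - err M ≤ Real.log e ∧
          (∀ a r, φ a r ∈ permClass f) ∧
          ∀ (a : Fin 3 → Fin e) (u : Fin 3 → Fin M → S),
            (∀ l r, coordOn S (l + r) ∘ u r = coordOn S (l + r) ∘ φ (a l) r) →
              a 0 = a 1 ∧ a 1 = a 2 := by
  obtain ⟨d, hd⟩ := hS
  obtain ⟨C, hC0, hC⟩ := exists_independent_triples (S := S) (c := coordOn S) (d := d)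
    (fun s => hd s s.2) (fun s s' h => by
      have h0 := h 0
      have h1 := h 1
      have h2 := h 2
      simp only [coordOn, tripleCoord, Matrix.cons_val] at h0 h1 h2
      exact Subtype.ext (Prod.ext h0 (Prod.ext h1 h2)))
  -- The `9` collects three Stirling errors each for `f`, for `u` and for the marginals. The next
  -- term comes from the number of types, the root from Behrend's bound with `log n ≤ log C + 3 M
  -- log |S|`.
  refine ⟨fun M => 9 * ((#S + 1) * (1 + Real.log (M + 1))) + 3 * (#S * Real.log (M + 1)) +
    (Real.log 32 + Real.log C) + 4 * √(Real.log C + 3 * Real.log #S * M), ?_, ?_⟩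
  · have h0 := tendsto_log_add_one_div
    have h1 := tendsto_sqrt_div (Real.log C) (3 * Real.log #S)
    have h2 := tendsto_const_div_atTop_nhds_zero_nat
      (9 * (#S + 1 : ℝ) + (Real.log 32 + Real.log C))
    have h3 := ((h0.const_mul (9 * (#S + 1 : ℝ) + 3 * #S)).add (h1.const_mul 4)).add h2
    simp only [mul_zero, add_zero] at h3
    refine h3.congr fun M => ?_
    ring
  · intro M f hM
    obtain ⟨n, e, φ, hn, hnC, hne, hφ, hind⟩ := hC M f
    obtain ⟨u, hu, hcard⟩ := exists_card_compatClass_le (coordOn S) f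
    have hA0 : 0 < #(compatClass (coordOn S) f) := card_pos.2 ⟨u, hu⟩
    have hB0 : 0 < #(permClass f) := card_pos.2 ⟨f, self_mem_permClass f⟩
    have hU0 : 0 < #(permClass u) := card_pos.2 ⟨u, self_mem_permClass u⟩
    have hN0 (l : Fin 3) : 0 < #(permClass (coordOn S l ∘ f)) :=
      card_pos.2 ⟨_, self_mem_permClass _⟩
    have hroth := Behrend.roth_lower_bound (N := n)
    have hr0 : (0 : ℝ) < n * Real.exp (-4 * √(Real.log n)) := by positivity
    have hne' : (#(permClass f) : ℝ) ^ 3 * (n * Real.exp (-4 * √(Real.log n))) ≤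
        32 * n ^ 2 * e := by
      calc _ ≤ (#(permClass f) : ℝ) ^ 3 * rothNumberNat n := by gcongr
        _ ≤ _ := by exact_mod_cast hne
    have he : 0 < e := by
      rcases Nat.eq_zero_or_pos e with rfl | h
      · have : 0 < (#(permClass f) : ℝ) ^ 3 * (n * Real.exp (-4 * √(Real.log n))) := by positivity
        simp only [Nat.cast_zero, mul_zero] at hne'
        linarith
      · exact h
    have hn' : (0 : ℝ) < n := by exact_mod_cast hn
    have hA' : (0 : ℝ) < #(compatClass (coordOn S) f) := by exact_mod_cast hA0
    have hB' : (0 : ℝ) < #(permClass f) := by exact_mod_cast hB0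
    have hU' : (0 : ℝ) < #(permClass u) := by exact_mod_cast hU0
    have he' : (0 : ℝ) < e := by exact_mod_cast he
    have hC' : (0 : ℝ) < C := by exact_mod_cast hC0
    have hP' : (0 : ℝ) < ∏ l, (#(permClass (coordOn S l ∘ f)) : ℝ) :=
      prod_pos fun l _ => by exact_mod_cast hN0 l
    have L1 : 3 * Real.log #(permClass f) - 4 * √(Real.log n) ≤
        Real.log 32 + Real.log n + Real.log e := by
      have h := Real.log_le_log (by positivity) hne'
      rw [Real.log_mul (by positivity) (by positivity), Real.log_mul (by positivity) (by positivity),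
        Real.log_mul (by positivity) (by positivity), Real.log_mul (by positivity) (by positivity),
        Real.log_pow, Real.log_pow, Real.log_exp] at h
      push_cast at h
      linarith
    have L2 : Real.log n + ∑ l, Real.log #(permClass (coordOn S l ∘ f)) ≤
        Real.log C + 3 * Real.log #(compatClass (coordOn S) f) := by
      have hnC' : (n : ℝ) * ∏ l, (#(permClass (coordOn S l ∘ f)) : ℝ) ≤
          C * (#(compatClass (coordOn S) f) : ℝ) ^ 3 := by exact_mod_cast hnC
      have h := Real.log_le_log (mul_pos hn' hP') hnC'
      rw [Real.log_mul hn'.ne' hP'.ne', Real.log_mul hC'.ne' (pow_pos hA' 3).ne', Real.log_pow, Real.log_prod fun l _ => by exact_mod_cast (hN0 l).ne'] at h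
      exact_mod_cast h
    have L3 : Real.log #(compatClass (coordOn S) f) ≤
        Real.log #(permClass u) + #S * Real.log (M + 1) := by
      have hcard' : (#(compatClass (coordOn S) f) : ℝ) ≤
          #(permClass u) * (M + 1 : ℝ) ^ (Fintype.card S) := by exact_mod_cast hcard
      have h := Real.log_le_log (by positivity) hcard'
      rw [Real.log_mul (by positivity) (by positivity), Real.log_pow, Fintype.card_coe] at h
      exact h
    have L4 : Real.log #(compatClass (coordOn S) f) ≤ M * Real.log #S := by
      have h1 : #(compatClass (coordOn S) f) ≤ #S ^ M := (card_le_univ _).trans (by simp)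
      have h := Real.log_le_log hA' (by exact_mod_cast h1 :
        (#(compatClass (coordOn S) f) : ℝ) ≤ (#S : ℝ) ^ M)
      rwa [Real.log_pow] at h
    have L5 : 0 ≤ ∑ l, Real.log #(permClass (coordOn S l ∘ f)) :=
      sum_nonneg fun l _ => Real.log_natCast_nonneg _
    have L6 : √(Real.log n) ≤ √(Real.log C + 3 * Real.log #S * M) :=
      Real.sqrt_le_sqrt (by linarith)
    have E1 := abs_le.1 (abs_log_card_permClass_sub_entropy_le hM f)
    have E2 := abs_le.1 (abs_log_card_permClass_sub_entropy_le hM u)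
    have E3 := fun l => abs_le.1 (abs_log_card_permClass_coord_sub_entropy_le hM f l)
    have E4 : M * ∑ l, shannonEntropy (marginal (freq f) l) -
        3 * ((#S + 1) * (1 + Real.log (M + 1))) ≤
        ∑ l, Real.log #(permClass (coordOn S l ∘ f)) := by
      have := sum_le_sum fun l (_ : l ∈ (univ : Finset (Fin 3))) => (E3 l).1
      rw [sum_sub_distrib, ← mul_sum, sum_const, card_univ, Fintype.card_fin, nsmul_eq_mul] at this
      push_cast at this
      linarith
    refine ⟨e, φ, u, he, compatible_of_mem_compatClass hu, ?_, hφ, hind⟩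
    have e1 := E1.1
    have e2 := E2.2
    nlinarith

end Entropy

/-! ### The lower bound for tensors with blocks -/

section LowerBound

open Finset

theorem exists_sequence_of_counts {S : Type*} [Fintype S] [DecidableEq S] (n : S → ℕ) :
    ∃ f : Fin (∑ s, n s) → S, ∀ s, #{m | f m = s} = n s := by
  have E : Fin (∑ s, n s) ≃ Σ s, Fin (n s) := Fintype.equivOfCardEq (by simp)
  refine ⟨fun m => (E m).1, fun s => ?_⟩
  rw [← Fintype.card_fin (n s), ← card_univ]
  symm
  refine card_bij (fun k _ => E.symm ⟨s, k⟩) (by simp) (fun k _ k' _ h => ?_) fun m hm => ?_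
  · simpa using h
  · obtain rfl : (E m).1 = s := (mem_filter.1 hm).2
    exact ⟨(E m).2, mem_univ _, by simp⟩

/-- Every distribution is the limit of the distributions of sequences without additional
support. -/
theorem exists_sequences_tendsto {S : Finset (ℤ × ℤ × ℤ)} {Q : S → ℝ}
    (hQ : Q ∈ stdSimplex ℝ S) :
    ∃ (M : ℕ → ℕ) (f : ∀ N, Fin (M N) → S), Tendsto M atTop atTop ∧
      Tendsto (fun N => freq (f N)) atTop (𝓝 Q) ∧
      (∀ s, Q s = 0 → ∀ N, #{m | f N m = s} = 0) ∧
      ∀ s, Q s ≠ 0 → Tendsto (fun N => #{m | f N m = s}) atTop atTop := by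
  -- Rounding down keeps zero weights at count zero, while all other counts tend to infinity, so the
  -- values of the components can be replaced by their limits.
  let n (N : ℕ) (s : S) : ℕ := ⌊Q s * N⌋₊
  choose f hf using fun N => exists_sequence_of_counts (n N)
  have hn (s : S) : Tendsto (fun N : ℕ => (n N s : ℝ) / N) atTop (𝓝 (Q s)) :=
    (tendsto_nat_floor_mul_div_atTop (hQ.1 s)).comp tendsto_natCast_atTop_atTop
  have hatTop {g : ℕ → ℕ} {a : ℝ} (ha : 0 < a)
      (h : Tendsto (fun N : ℕ => (g N : ℝ) / N) atTop (𝓝 a)) : Tendsto g atTop atTop := by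
    rw [← tendsto_natCast_atTop_iff (R := ℝ)]
    refine (h.pos_mul_atTop ha tendsto_natCast_atTop_atTop).congr' ?_
    filter_upwards [eventually_gt_atTop 0] with N hN
    field_simp
  have hM : Tendsto (fun N : ℕ => ((∑ s, n N s : ℕ) : ℝ) / N) atTop (𝓝 1) := by
    rw [← hQ.2]
    refine (tendsto_finsetSum univ fun s _ => hn s).congr fun N => ?_
    rw [Nat.cast_sum, sum_div]
  refine ⟨fun N => ∑ s, n N s, f, hatTop one_pos hM, ?_, ?_, ?_⟩
  · rw [tendsto_pi_nhds]
    intro s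
    have h1 := (hn s).div hM one_ne_zero
    rw [div_one] at h1
    refine h1.congr' ?_
    filter_upwards [eventually_gt_atTop 0] with N hN
    have hN' : (N : ℝ) ≠ 0 := by positivity
    simp only [Pi.div_apply, freq, hf]
    rw [div_div_div_cancel_right₀ hN']
  · intro s hs N
    rw [hf]
    simp [n, hs]
  · intro s hs
    simp only [hf]
    exact hatTop ((hQ.1 s).lt_of_ne' hs) (hn s)

-- Divide the combinatorial bound by `M` and pass to the limit. The competing frequencies need not
-- converge, but by compactness a subsequence tends to some `R'` compatible with `Q`, and `hmax`
-- makes the entropy difference nonnegative.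
open CoordTensor in
theorem le_log_value_of_blocks {F : Type*} [Field F] {S : Finset (ℤ × ℤ × ℤ)}
    (hS : IsTight S) {X Y Z : Type*} [Fintype X] [Fintype Y] [Fintype Z] {XS YS ZS : S → Type*}
    [∀ s, Fintype (XS s)] [∀ s, Fintype (YS s)] [∀ s, Fintype (ZS s)]
    {T : CoordTensor F X Y Z} {t : ∀ s, CoordTensor F (XS s) (YS s) (ZS s)}
    {fX : ∀ s, XS s → X} {fY : ∀ s, YS s → Y} {fZ : ∀ s, ZS s → Z}
    (hblock : ∀ s x y z, T (fX s x) (fY s y) (fZ s z) = t s x y z)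
    (hsupp : ∀ s s' s'' x y z, T (fX s x) (fY s' y) (fZ s'' z) ≠ 0 →
      ∃ u, coordOn S 0 u = coordOn S 0 s ∧ coordOn S 1 u = coordOn S 1 s' ∧
        coordOn S 2 u = coordOn S 2 s'')
    (ht : ∀ s, t s ≠ 0) {ρ : ℝ} (hρ : ρ ∈ Set.Icc (2 : ℝ) 3) {Q : S → ℝ}
    (hQ : Q ∈ stdSimplex ℝ S)
    (hmax : ∀ R ∈ stdSimplex ℝ S, Compatible R Q → shannonEntropy R ≤ shannonEntropy Q) :
    ∑ l, shannonEntropy (marginal Q l) / 3 + ∑ s, Q s * Real.log (value ρ (t s)) ≤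
      Real.log (value ρ T) := by
  have hT : T ≠ 0 := by
    rintro rfl
    obtain ⟨s, -, -⟩ := exists_ne_zero_of_sum_ne_zero (hQ.2.trans_ne one_ne_zero)
    exact ht s (funext fun x => funext fun y => funext fun z => (hblock s x y z).symm)
  obtain ⟨err, herr, hcomb⟩ := exists_independent_triples_of_isTight hS
  obtain ⟨M, f, hM, hfQ, hzero, hinf⟩ := exists_sequences_tendsto hQ
  have key (N : ℕ) : ∃ R ∈ stdSimplex ℝ S, 0 < M N → Compatible R (freq (f N)) ∧
      3 * shannonEntropy (freq (f N)) - 3 * shannonEntropy R +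
        ∑ l, shannonEntropy (marginal (freq (f N)) l) - err (M N) / M N +
        3 * ∑ s, freq (f N) s * Real.log (valueAt ρ #{m | f N m = s} (t s)) ≤
      3 * Real.log (valueAt ρ (M N) T) := by
    rcases Nat.eq_zero_or_pos (M N) with h0 | h0
    · exact ⟨Q, hQ, fun h => absurd h0 h.ne'⟩
    obtain ⟨e, φ, u, he, hu, hlog, hφ, hind⟩ := hcomb (M N) (f N) h0
    refine ⟨freq u, freq_mem_stdSimplex h0 u, fun _ => ⟨hu, ?_⟩⟩
    choose es ms hes hms hmem hv using fun s => exists_mem_valuePairs hρ.1 (ht s)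
      #{m | f N m = s}
    have h1 := log_le_of_mem_valuePairs hρ.1 hT h0
      (Nat.mul_pos he (prod_pos fun s _ => hes s)) (prod_pos fun s _ => hms s)
      (mem_valuePairs_of_blocks hblock hsupp hφ hind hmem)
    have h2 : Real.log (((e * ∏ s, es s : ℕ) : ℝ) * ((∏ s, ms s : ℕ) : ℝ) ^ ρ) =
        Real.log e + ∑ s, 3 * (#{m | f N m = s} : ℝ) *
          Real.log (valueAt ρ #{m | f N m = s} (t s)) := by
      have h3 : ∀ s, (es s : ℝ) * (ms s : ℝ) ^ ρ ≠ 0 := fun s => by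
        have := hes s
        have := hms s
        positivity
      rw [← sum_congr rfl fun s _ => hv s, ← Real.log_prod fun s _ => h3 s,
        ← Real.log_mul (by positivity) (prod_ne_zero_iff.2 fun s _ => h3 s)]
      push_cast
      rw [← Real.finsetProd_rpow _ _ fun s _ => Nat.cast_nonneg _, prod_mul_distrib, mul_assoc]
    rw [h2] at h1
    have hM0 : (0 : ℝ) < M N := by exact_mod_cast h0
    have h4 : (M N : ℝ) * ∑ s, freq (f N) s * Real.log (valueAt ρ #{m | f N m = s} (t s)) =
        ∑ s, (#{m | f N m = s} : ℝ) * Real.log (valueAt ρ #{m | f N m = s} (t s)) := by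
      rw [mul_sum]
      refine sum_congr rfl fun s _ => ?_
      rw [freq]
      field_simp
    simp only [mul_assoc, ← mul_sum] at h1
    have h5 : (M N : ℝ) * (err (M N) / M N) = err (M N) := by field_simp
    refine le_of_mul_le_mul_left ?_ hM0
    rw [← h4] at h1
    linarith
  choose R hR hkey using key
  obtain ⟨R', hR', ψ, hψ, hlim⟩ := (isCompact_stdSimplex ℝ S).tendsto_subseq hR
  have hψ' := hψ.tendsto_atTop
  have hpos : ∀ᶠ N in atTop, 0 < M (ψ N) := (hM.comp hψ').eventually_gt_atTop 0
  have hfψ : Tendsto (fun N => freq (f (ψ N))) atTop (𝓝 Q) := hfQ.comp hψ'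
  have hcompat : Compatible R' Q := fun l => by
    refine tendsto_nhds_unique_of_eventuallyEq (((continuous_marginal l).tendsto _).comp hlim)
      (((continuous_marginal l).tendsto _).comp hfψ) ?_
    filter_upwards [hpos] with N hN
    exact (hkey _ hN).1 l
  have hval (s : S) : Tendsto (fun N => freq (f (ψ N)) s *
      Real.log (valueAt ρ #{m | f (ψ N) m = s} (t s))) atTop
      (𝓝 (Q s * Real.log (value ρ (t s)))) := by
    by_cases h0 : Q s = 0
    · have : ∀ N, freq (f (ψ N)) s = 0 := fun N => by simp [freq, hzero s h0]
      simp [this, h0]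
    · exact (tendsto_pi_nhds.1 hfψ s).mul
        ((tendsto_log_valueAt hρ (ht s)).comp ((hinf s h0).comp hψ'))
  have hfinal := le_of_tendsto_of_tendsto (((((((continuous_shannonEntropy.tendsto _).comp
    hfψ).const_mul 3).sub (((continuous_shannonEntropy.tendsto _).comp hlim).const_mul 3)).add
    (tendsto_finsetSum univ fun l _ => ((continuous_shannonEntropy.comp
      (continuous_marginal l)).tendsto _).comp hfψ)).sub
    (herr.comp (hM.comp hψ'))).add ((tendsto_finsetSum univ fun s _ => hval s).const_mul 3))
    (((tendsto_log_valueAt hρ hT).comp (hM.comp hψ')).const_mul 3)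
    (hpos.mono fun N hN => (hkey _ hN).2)
  have h6 := hmax R' hR' hcompat
  simp only [Function.comp] at hfinal
  rw [← sum_div]
  linarith

end LowerBound

/-! ### Change of bases -/

namespace CoordTensor

theorem value_mono {F : Type*} [Field F] {X Y Z X' Y' Z' : Type*} [Fintype X] [Fintype Y]
    [Fintype Z] [Fintype X'] [Fintype Y'] [Fintype Z'] {t : CoordTensor F X Y Z}
    {t' : CoordTensor F X' Y' Z'} (h : DegeneratesTo t t') (ht : t ≠ 0) (ht' : t' ≠ 0) {ρ : ℝ}
    (hρ : ρ ∈ Set.Icc (2 : ℝ) 3) : value ρ t' ≤ value ρ t := by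
  refine le_of_tendsto_of_tendsto (valueWellDefined hρ ht').2.1 (valueWellDefined hρ ht).2.1 ?_
  filter_upwards [eventually_gt_atTop 0] with N hN
  exact (isGreatest_valueAt hρ.1 ht hN).2
    (Set.image_mono (valuePairs_mono h N) (isGreatest_valueAt hρ.1 ht' hN).1)

end CoordTensor

section Bases

variable {F : Type*} [Field F]
variable {U V W U' V' W' : Type*} [AddCommGroup U] [Module F U] [AddCommGroup V] [Module F V]
  [AddCommGroup W] [Module F W] [AddCommGroup U'] [Module F U'] [AddCommGroup V'] [Module F V']
  [AddCommGroup W'] [Module F W']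
variable {X Y Z X' Y' Z' : Type*}

open Module

/-- The coefficients of a tensor with respect to given bases. -/
noncomputable def basisCoords (bU : Basis X F U) (bV : Basis Y F V) (bW : Basis Z F W)
    (t : U ⊗[F] V ⊗[F] W) : CoordTensor F X Y Z :=
  fun x y z => ((bU.tensorProduct bV).tensorProduct bW).repr t ((x, y), z)

theorem basisCoords_sum (bU : Basis X F U) (bV : Basis Y F V) (bW : Basis Z F W) {ι : Type*}
    (s : Finset ι) (t : ι → U ⊗[F] V ⊗[F] W) (x : X) (y : Y) (z : Z) :
    basisCoords bU bV bW (∑ i ∈ s, t i) x y z = ∑ i ∈ s, basisCoords bU bV bW (t i) x y z := by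
  simp [basisCoords]

theorem basisCoords_ne_zero (bU : Basis X F U) (bV : Basis Y F V) (bW : Basis Z F W)
    {t : U ⊗[F] V ⊗[F] W} (ht : t ≠ 0) : basisCoords bU bV bW t ≠ 0 := by
  intro h
  refine ht (((bU.tensorProduct bV).tensorProduct bW).repr.map_eq_zero_iff.1 ?_)
  ext ⟨⟨x, y⟩, z⟩
  exact congrFun (congrFun (congrFun h x) y) z

theorem tensorCoords_ne_zero [FiniteDimensional F U] [FiniteDimensional F V]
    [FiniteDimensional F W] {t : U ⊗[F] V ⊗[F] W} (ht : t ≠ 0) : tensorCoords t ≠ 0 :=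
  basisCoords_ne_zero (finBasis F U) (finBasis F V) (finBasis F W) ht

/-- Base change is a contraction by transition matrices. It allows the value to be estimated in
bases adapted to the decomposition. -/
theorem degeneratesTo_basisCoords [Fintype X] [Fintype Y] [Fintype Z]
    (bU : Basis X F U) (bV : Basis Y F V) (bW : Basis Z F W)
    (bU' : Basis X' F U) (bV' : Basis Y' F V) (bW' : Basis Z' F W) (t : U ⊗[F] V ⊗[F] W) :
    CoordTensor.DegeneratesTo (basisCoords bU bV bW t) (basisCoords bU' bV' bW' t) := by
  have : basisCoords bU' bV' bW' t = CoordTensor.contract (fun x' x => bU'.repr (bU x) x')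
      (fun y' y => bV'.repr (bV y) y') (fun z' z => bW'.repr (bW z) z')
      (basisCoords bU bV bW t) := by
    funext x' y' z'
    conv_lhs =>
      rw [basisCoords, ← ((bU.tensorProduct bV).tensorProduct bW).sum_repr t]
    simp only [map_sum, map_smul, Finsupp.coe_finsetSum, Finset.sum_apply, Finsupp.smul_apply,
      Fintype.sum_prod_type, Basis.tensorProduct_apply, Basis.tensorProduct_repr_tmul_apply,
      smul_eq_mul, CoordTensor.contract, basisCoords]
    refine Finset.sum_congr rfl fun x _ => Finset.sum_congr rfl fun y _ =>
      Finset.sum_congr rfl fun z _ => ?_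
    ring
  rw [this]
  exact .of_contract _ _ _

theorem basisCoords_map_eq {bU : Basis X F U} {bV : Basis Y F V} {bW : Basis Z F W}
    {bU' : Basis X' F U'} {bV' : Basis Y' F V'} {bW' : Basis Z' F W'}
    {gU : U' →ₗ[F] U} {gV : V' →ₗ[F] V} {gW : W' →ₗ[F] W} {x : X} {y : Y} {z : Z}
    {x' : X'} {y' : Y'} {z' : Z'} (hU : ∀ u, bU.repr (gU u) x = bU'.repr u x')
    (hV : ∀ v, bV.repr (gV v) y = bV'.repr v y') (hW : ∀ w, bW.repr (gW w) z = bW'.repr w z')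
    (t : U' ⊗[F] V' ⊗[F] W') :
    basisCoords bU bV bW (TensorProduct.map (TensorProduct.map gU gV) gW t) x y z =
      basisCoords bU' bV' bW' t x' y' z' := by
  unfold basisCoords
  induction t with
  | zero => simp
  | add a b ha hb => simp only [map_add, Finsupp.add_apply, ha, hb]
  | tmul a w =>
    induction a with
    | zero => simp
    | add a b ha hb => simp only [TensorProduct.add_tmul, map_add, Finsupp.add_apply, ha, hb]
    | tmul u v =>
      simp only [TensorProduct.map_tmul, Basis.tensorProduct_repr_tmul_apply, hU, hV, hW]

theorem basisCoords_map_eq_zero {bU : Basis X F U} {bV : Basis Y F V} {bW : Basis Z F W}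
    {gU : U' →ₗ[F] U} {gV : V' →ₗ[F] V} {gW : W' →ₗ[F] W} {x : X} {y : Y} {z : Z}
    (h : (∀ u, bU.repr (gU u) x = 0) ∨ (∀ v, bV.repr (gV v) y = 0) ∨
      (∀ w, bW.repr (gW w) z = 0)) (t : U' ⊗[F] V' ⊗[F] W') :
    basisCoords bU bV bW (TensorProduct.map (TensorProduct.map gU gV) gW t) x y z = 0 := by
  unfold basisCoords
  induction t with
  | zero => simp
  | add a b ha hb => simp only [map_add, Finsupp.add_apply, ha, hb, add_zero]
  | tmul a w =>
    induction a with
    | zero => simp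
    | add a b ha hb =>
      simp only [TensorProduct.add_tmul, map_add, Finsupp.add_apply, ha, hb, add_zero]
    | tmul u v =>
      simp only [TensorProduct.map_tmul, Basis.tensorProduct_repr_tmul_apply]
      rcases h with h | h | h <;> simp [h]

end Bases

/-! ### Bases adapted to a decomposition -/

namespace TensorDecomposition

open Module

variable {F : Type*} [Field F]
variable {U V W : Type*} [AddCommGroup U] [Module F U] [AddCommGroup V] [Module F V]
  [AddCommGroup W] [Module F W]
variable {t : U ⊗[F] V ⊗[F] W} (D : TensorDecomposition t)

theorem mem_supp {s : ℤ × ℤ × ℤ} :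
    s ∈ D.supp ↔ (s.1 ∈ D.I ∧ s.2.1 ∈ D.J ∧ s.2.2 ∈ D.K) ∧ D.comp s ≠ 0 := by
  simp [supp]

variable [FiniteDimensional F U] [FiniteDimensional F V] [FiniteDimensional F W]

/-- The coefficients of a tensor with respect to bases adapted to a decomposition. -/
noncomputable def adaptedCoords :
    CoordTensor F (Σ i : D.I, Fin (finrank F (D.subU i))) (Σ j : D.J, Fin (finrank F (D.subV j)))
      (Σ k : D.K, Fin (finrank F (D.subW k))) :=
  basisCoords (D.internalU.collectedBasis fun i => finBasis F (D.subU i))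
    (D.internalV.collectedBasis fun j => finBasis F (D.subV j))
    (D.internalW.collectedBasis fun k => finBasis F (D.subW k)) t

theorem adaptedCoords_eq_sum (x y z) : D.adaptedCoords x y z = ∑ s ∈ D.I ×ˢ D.J ×ˢ D.K,
    basisCoords (D.internalU.collectedBasis fun i => finBasis F (D.subU i))
      (D.internalV.collectedBasis fun j => finBasis F (D.subV j))
      (D.internalW.collectedBasis fun k => finBasis F (D.subW k))
      (TensorProduct.map
        (TensorProduct.map (D.subU s.1).subtype (D.subV s.2.1).subtype) (D.subW s.2.2).subtype
        (D.comp s)) x y z := by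
  rw [adaptedCoords, ← basisCoords_sum]
  exact congrArg (fun τ => basisCoords _ _ _ τ x y z) D.sum_comp.symm

theorem basisCoords_comp_eq_zero {s : ℤ × ℤ × ℤ} (hs : s ∈ D.I ×ˢ D.J ×ˢ D.K)
    (x : Σ i : D.I, Fin (finrank F (D.subU i))) (y : Σ j : D.J, Fin (finrank F (D.subV j)))
    (z : Σ k : D.K, Fin (finrank F (D.subW k)))
    (h : s.1 ≠ x.1 ∨ s.2.1 ≠ y.1 ∨ s.2.2 ≠ z.1) :
    basisCoords (D.internalU.collectedBasis fun i => finBasis F (D.subU i))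
      (D.internalV.collectedBasis fun j => finBasis F (D.subV j))
      (D.internalW.collectedBasis fun k => finBasis F (D.subW k))
      (TensorProduct.map
        (TensorProduct.map (D.subU s.1).subtype (D.subV s.2.1).subtype) (D.subW s.2.2).subtype
        (D.comp s)) x y z = 0 := by
  simp only [Finset.mem_product] at hs
  refine basisCoords_map_eq_zero ?_ _
  rcases h with h | h | h
  · exact Or.inl fun u => D.internalU.collectedBasis_repr_of_mem_ne _ (i := ⟨s.1, hs.1⟩)
      (fun he => h (congrArg Subtype.val he)) u.2
  · exact Or.inr (Or.inl fun u => D.internalV.collectedBasis_repr_of_mem_ne _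
      (i := ⟨s.2.1, hs.2.1⟩) (fun he => h (congrArg Subtype.val he)) u.2)
  · exact Or.inr (Or.inr fun u => D.internalW.collectedBasis_repr_of_mem_ne _
      (i := ⟨s.2.2, hs.2.2⟩) (fun he => h (congrArg Subtype.val he)) u.2)

theorem adaptedCoords_block (s : D.supp) (x : Fin (finrank F (D.subU s.1.1)))
    (y : Fin (finrank F (D.subV s.1.2.1))) (z : Fin (finrank F (D.subW s.1.2.2))) :
    D.adaptedCoords ⟨⟨s.1.1, (D.mem_supp.1 s.2).1.1⟩, x⟩ ⟨⟨s.1.2.1, (D.mem_supp.1 s.2).1.2.1⟩, y⟩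
      ⟨⟨s.1.2.2, (D.mem_supp.1 s.2).1.2.2⟩, z⟩ = tensorCoords (D.comp s) x y z := by
  rw [adaptedCoords_eq_sum, Finset.sum_eq_single s.1]
  · exact basisCoords_map_eq (bU' := finBasis F (D.subU s.1.1))
      (bV' := finBasis F (D.subV s.1.2.1)) (bW' := finBasis F (D.subW s.1.2.2))
      (fun u => D.internalU.collectedBasis_repr_of_mem _ (i := ⟨s.1.1, _⟩) u.2)
      (fun v => D.internalV.collectedBasis_repr_of_mem _ (i := ⟨s.1.2.1, _⟩) v.2)
      (fun w => D.internalW.collectedBasis_repr_of_mem _ (i := ⟨s.1.2.2, _⟩) w.2) (D.comp s)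
  · intro r hr hne
    refine D.basisCoords_comp_eq_zero hr _ _ _ ?_
    by_contra! h
    exact hne (Prod.ext h.1 (Prod.ext h.2.1 h.2.2))
  · intro h
    simp only [Finset.mem_product] at h
    exact absurd (D.mem_supp.1 s.2).1 h

theorem exists_mem_supp_of_adaptedCoords_ne_zero {x y z} (h : D.adaptedCoords x y z ≠ 0) :
    ∃ s ∈ D.supp, s.1 = x.1 ∧ s.2.1 = y.1 ∧ s.2.2 = z.1 := by
  rw [adaptedCoords_eq_sum] at h
  obtain ⟨s, hs, h⟩ := Finset.exists_ne_zero_of_sum_ne_zero h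
  refine ⟨s, D.mem_supp.2 ⟨by simpa using hs, fun h0 => h ?_⟩, ?_⟩
  · rw [h0]
    simp [basisCoords]
  · by_contra hne
    exact h (D.basisCoords_comp_eq_zero hs _ _ _ (by tauto))

end TensorDecomposition

/-! ### Concavity and the two optimization problems -/

section Concavity

variable {S : Finset (ℤ × ℤ × ℤ)}

theorem strictConcaveOn_shannonEntropy {α : Type*} [Fintype α] :
    StrictConcaveOn ℝ {p : α → ℝ | ∀ x, 0 ≤ p x} shannonEntropy := by
  refine ⟨fun p hp q hq a b ha hb _ x => ?_, fun p hp q hq hne a b ha hb hab => ?_⟩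
  · exact add_nonneg (mul_nonneg ha (hp x)) (mul_nonneg hb (hq x))
  · obtain ⟨y, hy⟩ := Function.ne_iff.1 hne
    simp only [shannonEntropy_eq_sum_negMulLog, smul_eq_mul, Finset.mul_sum,
      ← Finset.sum_add_distrib]
    refine Finset.sum_lt_sum (fun x _ => ?_) ⟨y, Finset.mem_univ _, ?_⟩
    · exact Real.concaveOn_negMulLog.2 (hp x) (hq x) ha.le hb.le hab
    · exact Real.strictConcaveOn_negMulLog.2 (hp y) (hq y) hy ha hb hab

theorem marginal_combination (P Q : S → ℝ) (a b : ℝ) (l : Fin 3) :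
    marginal (a • P + b • Q) l = a • marginal P l + b • marginal Q l := by
  funext x
  simp [marginal, Finset.sum_add_distrib, Finset.mul_sum]

theorem marginal_nonneg {P : S → ℝ} (hP : P ∈ stdSimplex ℝ S) (l : Fin 3) :
    marginal P l ∈ {p | ∀ x, 0 ≤ p x} :=
  fun _ => Finset.sum_nonneg fun s _ => hP.1 s

theorem convex_setOf_compatible (P : S → ℝ) :
    Convex ℝ {R | R ∈ stdSimplex ℝ S ∧ Compatible R P} := by
  intro R hR R' hR' a b ha hb hab
  refine ⟨convex_stdSimplex ℝ S hR.1 hR'.1 ha hb hab, fun l => ?_⟩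
  rw [marginal_combination, hR.2 l, hR'.2 l, ← add_smul, hab, one_smul]

theorem isCompact_setOf_compatible (P : S → ℝ) :
    IsCompact {R | R ∈ stdSimplex ℝ S ∧ Compatible R P} := by
  refine (isCompact_stdSimplex ℝ S).inter_right (t := {R | Compatible R P}) ?_
  simp only [Compatible, Set.ofPred_forall]
  exact isClosed_iInter fun l => isClosed_eq (continuous_marginal l) continuous_const

namespace TensorDecomposition

variable {F : Type*} [Field F]
variable {U V W : Type*} [AddCommGroup U] [Module F U] [AddCommGroup V] [Module F V]
  [AddCommGroup W] [Module F W]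
variable {t : U ⊗[F] V ⊗[F] W} (D : TensorDecomposition t)

theorem existsUnique_isSolution2 {P : D.supp → ℝ} (hP : P ∈ stdSimplex ℝ D.supp) :
    ∃! Q, D.IsSolution2 P Q := by
  obtain ⟨Q, hQ, hmax⟩ := (isCompact_setOf_compatible P).exists_isMaxOn ⟨P, hP, fun _ => rfl⟩
    continuous_shannonEntropy.continuousOn
  refine ⟨Q, ⟨hQ, hmax⟩, fun Q' hQ' => ?_⟩
  exact (strictConcaveOn_shannonEntropy.subset (fun R hR x => hR.1.1 x)
    (convex_setOf_compatible P)).eq_of_isMaxOn hQ'.2 hmax hQ'.1 hQ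

theorem isSolution2_congr {P P' Q : D.supp → ℝ} (h : Compatible P P') (hQ : D.IsSolution2 P Q) :
    D.IsSolution2 P' Q := by
  have : {R | R ∈ stdSimplex ℝ D.supp ∧ Compatible R P'} =
      {R | R ∈ stdSimplex ℝ D.supp ∧ Compatible R P} :=
    Set.ext fun R => and_congr_right fun _ => forall_congr' fun l => by rw [h l]
  rw [IsSolution2, this]
  exact hQ

theorem supp_nonempty (ht : t ≠ 0) : D.supp.Nonempty := by
  by_contra hempty
  refine ht (D.sum_comp.symm.trans (Finset.sum_eq_zero fun s hs => ?_))
  have : D.comp s = 0 := by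
    by_contra hne
    exact hempty ⟨s, D.mem_supp.2 ⟨by simpa using hs, hne⟩⟩
  rw [this, map_zero]

variable [FiniteDimensional F U] [FiniteDimensional F V] [FiniteDimensional F W] (ρ : ℝ)

theorem continuous_Psi : Continuous (D.Psi ρ) := by
  unfold Psi
  refine Continuous.add (continuous_finsetSum _ fun l _ => ?_) (by fun_prop)
  exact (continuous_shannonEntropy.comp (continuous_marginal l)).div_const 3

/-- The linear part cancels, so the concavity defect of `Ψ` is that of the marginal entropies alone.
This gives both concavity and strictness in the marginals. -/
theorem Psi_combination (P Q : D.supp → ℝ) (a b : ℝ) :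
    D.Psi ρ (a • P + b • Q) - (a * D.Psi ρ P + b * D.Psi ρ Q) =
      ∑ l, (shannonEntropy (a • marginal P l + b • marginal Q l) -
        (a * shannonEntropy (marginal P l) + b * shannonEntropy (marginal Q l))) / 3 := by
  simp only [Psi, marginal_combination, Pi.add_apply, Pi.smul_apply, smul_eq_mul, add_mul,
    Finset.sum_add_distrib, mul_assoc, ← Finset.mul_sum, ← Finset.sum_div, Finset.sum_sub_distrib]
  ring

theorem concaveOn_Psi : ConcaveOn ℝ (stdSimplex ℝ D.supp) (D.Psi ρ) := by
  refine ⟨convex_stdSimplex ℝ _, fun P hP Q hQ a b ha hb hab => ?_⟩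
  rw [smul_eq_mul, smul_eq_mul, ← sub_nonneg, Psi_combination]
  refine Finset.sum_nonneg fun l _ => div_nonneg (sub_nonneg.2 ?_) (by norm_num)
  exact strictConcaveOn_shannonEntropy.concaveOn.2 (marginal_nonneg hP l) (marginal_nonneg hQ l)
    ha hb hab

/-- If two maximizers had different marginals, their midpoint would have a larger `Ψ`. -/
theorem compatible_of_isSolution1 {P Q : D.supp → ℝ} (hP : D.IsSolution1 ρ P)
    (hQ : D.IsSolution1 ρ Q) : Compatible P Q := by
  by_contra hne
  simp only [Compatible, not_forall] at hne
  obtain ⟨l₀, hl₀⟩ := hne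
  have ha : (0 : ℝ) < 1 / 2 := by norm_num
  have hab : (1 / 2 : ℝ) + 1 / 2 = 1 := by norm_num
  have hlt : 0 < D.Psi ρ ((1 / 2 : ℝ) • P + (1 / 2 : ℝ) • Q) -
      (1 / 2 * D.Psi ρ P + 1 / 2 * D.Psi ρ Q) := by
    rw [Psi_combination]
    refine Finset.sum_pos' (fun l _ => div_nonneg (sub_nonneg.2 ?_) (by norm_num))
      ⟨l₀, Finset.mem_univ _, div_pos (sub_pos.2 ?_) (by norm_num)⟩
    · exact strictConcaveOn_shannonEntropy.concaveOn.2 (marginal_nonneg hP.1 l)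
        (marginal_nonneg hQ.1 l) ha.le ha.le hab
    · exact strictConcaveOn_shannonEntropy.2 (marginal_nonneg hP.1 l₀)
        (marginal_nonneg hQ.1 l₀) hl₀ ha ha hab
  have hmem := convex_stdSimplex ℝ _ hP.1 hQ.1 ha.le ha.le hab
  have h1 := hP.2 hmem
  have h2 := hQ.2 hmem
  simp only [Set.mem_ofPred_eq] at h1 h2
  linarith

theorem exists_isSolution1 (hne : D.supp.Nonempty) : ∃ P, D.IsSolution1 ρ P := by
  obtain ⟨s, hs⟩ := hne
  obtain ⟨P, hP, hmax⟩ := (isCompact_stdSimplex ℝ D.supp).exists_isMaxOn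
    ⟨_, single_mem_stdSimplex ℝ (⟨s, hs⟩ : D.supp)⟩ (D.continuous_Psi ρ).continuousOn
  exact ⟨P, hP, hmax⟩

theorem Psi_le_log_tensorValue (ht : t ≠ 0) (hD : IsTight D.supp) {ρ : ℝ}
    (hρ : ρ ∈ Set.Icc (2 : ℝ) 3) {P Q : D.supp → ℝ} (hQ : D.IsSolution2 P Q) :
    D.Psi ρ Q ≤ Real.log (tensorValue ρ t) := by
  have hcomp (s : D.supp) : tensorCoords (D.comp s) ≠ 0 :=
    tensorCoords_ne_zero (D.mem_supp.1 s.2).2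
  have h1 := le_log_value_of_blocks hD (T := D.adaptedCoords)
    (t := fun s : D.supp => tensorCoords (D.comp s))
    (fX := fun s x => ⟨⟨s.1.1, (D.mem_supp.1 s.2).1.1⟩, x⟩)
    (fY := fun s y => ⟨⟨s.1.2.1, (D.mem_supp.1 s.2).1.2.1⟩, y⟩)
    (fZ := fun s z => ⟨⟨s.1.2.2, (D.mem_supp.1 s.2).1.2.2⟩, z⟩)
    D.adaptedCoords_block
    (fun s s' s'' x y z h => by
      obtain ⟨u, hu, h0, h1, h2⟩ := D.exists_mem_supp_of_adaptedCoords_ne_zero h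
      exact ⟨⟨u, hu⟩, h0, h1, h2⟩)
    hcomp hρ hQ.1.1 (fun R hR hRQ => hQ.2 ⟨hR, fun l => (hRQ l).trans (hQ.1.2 l)⟩)
  have hadapted : D.adaptedCoords ≠ 0 := basisCoords_ne_zero _ _ _ ht
  refine h1.trans (Real.log_le_log (CoordTensor.valueWellDefined hρ hadapted).2.2 ?_)
  exact CoordTensor.value_mono (degeneratesTo_basisCoords _ _ _ _ _ _ t) (tensorCoords_ne_zero ht)
    hadapted hρ

end TensorDecomposition

end Concavity

theorem theorem4p2 {F : Type*} [Field F]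
    {U V W : Type*} [AddCommGroup U] [Module F U] [FiniteDimensional F U]
    [AddCommGroup V] [Module F V] [FiniteDimensional F V]
    [AddCommGroup W] [Module F W] [FiniteDimensional F W]
    (t : U ⊗[F] V ⊗[F] W) (ht : t ≠ 0)
    (D : TensorDecomposition t) (hD : IsTight D.supp)
    (ρ : ℝ) (hρ : ρ ∈ Set.Icc (2 : ℝ) 3) :
    -- the values of `t` and of its components are well defined and positive
    (tensorCoords t).ValueWellDefined ρ ∧
    (∀ s ∈ D.supp, (tensorCoords (D.comp s)).ValueWellDefined ρ) ∧
    -- the first problem is the maximization of a concave function, and has a solution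
    ConcaveOn ℝ (stdSimplex ℝ D.supp) (D.Psi ρ) ∧
    (∃ P, D.IsSolution1 ρ P) ∧
    -- the second problem has exactly one solution
    (∀ P, D.IsSolution1 ρ P → ∃! Q, D.IsSolution2 P Q) ∧
    -- the output is unique, whichever solution of the first problem is used
    (∃! v, D.IsOutputA ρ v) ∧
    -- the output is a lower bound on `log V_ρ(t)`
    (∀ v, D.IsOutputA ρ v → v ≤ Real.log (tensorValue ρ t)) := by
  refine ⟨CoordTensor.valueWellDefined hρ (tensorCoords_ne_zero ht),
    fun s hs => CoordTensor.valueWellDefined hρ (tensorCoords_ne_zero (D.mem_supp.1 hs).2),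
    D.concaveOn_Psi ρ, D.exists_isSolution1 ρ (D.supp_nonempty ht),
    fun P hP => D.existsUnique_isSolution2 hP.1, ?_, ?_⟩
  · obtain ⟨P, hP⟩ := D.exists_isSolution1 ρ (D.supp_nonempty ht)
    obtain ⟨Q, hQ, huniq⟩ := D.existsUnique_isSolution2 hP.1
    refine ⟨D.Psi ρ Q, ⟨P, Q, hP, hQ, rfl⟩, ?_⟩
    rintro _ ⟨P', Q', hP', hQ', rfl⟩
    rw [huniq Q' (D.isSolution2_congr (D.compatible_of_isSolution1 ρ hP' hP) hQ')]
  · rintro _ ⟨P, Q, -, hQ, rfl⟩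
    exact D.Psi_le_log_tensorValue ht hD hρ hQ
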